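/- **Setting.** Let $V$ be a separable Banach space, $T\in\mathbb N_0$, $I=\{0,1,\dots,T\}$ and $r\ge 0$. For $U\subseteq V$ let $\mathcal S(U)$ be the collection of adapted processes $\mathbf X=(\Omega,\mathbb P,(\mathcal F_t)_{t\in I},X)$, where $(\Omega,\mathbb P,(\mathcal F_t)_{t\in I})$ is a filtered probability space and $X_t:\Omega\to U$ is $\mathcal F_t$-measurable for every $t\in I$. *Adapted functionals.* $\mathrm{AF}$ is the smallest class of maps from $\mathcal S(U)$ to bounded random variables that contains $\mathbf X\mapsto f(X_{t_1},\dots,X_{t_n})$ for $f\in C_b(U^n,\mathbb R)$, and with $f_1,\dots,f_n$ also $\mathbf X\mapsto g(f_1(\mathbf X),\dots,f_n(\mathbf X))$ for $g\in C_b(\mathbb R^n,\mathbb R)$, and with $f$ also $\mathbf X\mapsto\mathbb E[f(\mathbf X)\mid\mathcal F_t]$ for $t\in I$. $\mathrm{AF}_r$ consists of those with a construction in which at most $r$ conditional expectations are nested. The adapted topology $\tau_r$ on $\mathcal S(U)$ is the coarsest one for which $\mathbf X\mapsto\mathbb E[f(\mathbf X)]$ is continuous for all $f\in\mathrm{AF}_r$.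 *Prediction processes.* Put $\mathrm{Prob}_0(U)=U$ and $\mathrm{Prob}_{k+1}(U)=\mathrm{Prob}(I\to\mathrm{Prob}_k(U))$ (Borel probability measures with the weak topology). Let $\hat X^0=X$ and $\hat X^{k+1}_t=\mathbb P(\hat X^k\in\cdot\mid\mathcal F_t)$ (regular conditional distributions), so that $\mathrm{Law}(\hat X^k)\in\mathrm{Prob}_{k+1}(U)$. The extended weak topology $\hat\tau_r$ on $\mathcal S(U)$ is the initial topology of $\mathbf X\mapsto\mathrm{Law}(\hat X^r)$. *Signatures.* For every normed space $W$ that occurs below fix norms on the algebraic tensor powers $W^{\otimes m}$, $m\ge0$, that are admissible, i.e. $\|v_1\otimes\dots\otimes v_m\|\le\prod_i\|v_i\|$, $\|s\otimes t\|\le\|s\|\|t\|$ for $s\in W^{\otimes m}$, $t\in W^{\otimes n}$, and $|(\ell_1\otimes\dots\otimes\ell_m)(t)|\le\prod_i\|\ell_i\|\,\|t\|$ for $\ell_i\in W^*$ (for example the projective or the injective norms). Let $\mathbf T(W)$ be the completion of $\bigoplus_{m\ge0}W^{\otimes m}$ under $\|t\|=\sum_m\|t_m\|$, and put $\mathbf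 T^0(V)=V$, $\mathbf T^{k+1}(V)=\mathbf T(\mathbb R\oplus\mathbf T^k(V))$, where $\|(s,w)\|=|s|+\|w\|$ on $\mathbb R\oplus W$. The signature of $x:I\to W$ is $$S(x)=\exp(\Delta_0x)\cdot\exp(\Delta_1x)\cdots\exp(\Delta_Tx)\in\mathbf T(\mathbb R\oplus W),\qquad \Delta_0x=(1,x(0)),\quad \Delta_tx=(1,x(t)-x(t-1)),$$ with $\exp(v)=(v^{\otimes m}/m!)_{m\ge0}$ and the tensor convolution product. A tensor normalization of $\mathbf T(W)$ is a bounded, continuous, injective map $\Lambda:\{t\in\mathbf T(W):t_0=1\}\to\mathbf T(W)$ of the form $\Lambda(t)=(\lambda(t)^mt_m)_{m\ge0}$ with $\lambda(t)>0$. Fix tensor normalizations for all spaces that occur; the robust signature is $\Lambda\circ S$. For $F=\Lambda\circ S$ (robust) or $F=S$ (classical) define $\bar F^0(x)=x$ and $$\bar F^{k+1}(\mu)=\int F\big(t\mapsto\bar F^k(x(t))\big)\,\mu(dx)\in\mathbf T^{k+1}(V),\qquad \mu\in\mathrm{Prob}_{k+1}(U),$$ and $\Phi_r(\mathbf X)=\bar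 F^{r+1}(\mathrm{Law}(\hat X^r))$, $d_r(\mathbf X,\mathbf Y)=\|\Phi_r(\mathbf X)-\Phi_r(\mathbf Y)\|$. **Theorem.** For every choice of admissible norms and of tensor normalizations the following holds. 1. Let $\Phi_r$ and $d_r$ be defined with the robust signature. For $\mathbf X,\mathbf Y\in\mathcal S(V)$, $$\mathbb E[f(\mathbf X)]=\mathbb E[f(\mathbf Y)]\ \text{ for all } f\in\mathrm{AF}_r\quad\Longleftrightarrow\quad\Phi_r(\mathbf X)=\Phi_r(\mathbf Y).$$ 2. With the same $\Phi_r$ and $d_r$: $\Phi_r$ locally induces $\tau_r$ and $d_r$ locally metrizes $\tau_r$. That is, on every subset $\mathcal K$ of $\mathcal S(V)$ that is compact for $\hat\tau_r$, the following topologies coincide: the one induced by $\tau_r$, the initial topology of $\Phi_r|_{\mathcal K}$, the topology of the semimetric $d_r|_{\mathcal K\times\mathcal K}$, and the one induced by $\hat\tau_r$. 3. If $K\subset V$ is compact, the statements hold on $\mathcal S(K)$ without localization, with the robust signature as well as with the classical signature in the definition of $\Phi_r$ and $d_r$: for $\mathbf X,\mathbf Y\in\mathcal S(K)$ the equivalence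 in 1 holds, and the topologies $\tau_r$, $\hat\tau_r$, the initial topology of $\Phi_r$ and the topology of the semimetric $d_r$ on $\mathcal S(K)$ are equal. -/

import Mathlib

open MeasureTheory Topology
open scoped TensorProduct BoundedContinuousFunction

universe u w

noncomputable section

namespace AdaptedSig

/-! ### Adapted processes and adapted functionals -/

/-- An adapted stochastic process indexed by `I = {0, …, T}` with state space `U`: a filtered
probability space together with a process such that `X t` is `ℱ t`-measurable for each `t`. -/
structure AdaptedProcess (T : ℕ) (U : Type u) [MeasurableSpace U] where
  Ω : Type w
  mΩ : MeasurableSpace Ω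
  P : Measure Ω
  isProb : IsProbabilityMeasure P
  ℱ : Filtration (Fin (T + 1)) mΩ
  X : Fin (T + 1) → Ω → U
  adapted : ∀ t, Measurable[ℱ t] (X t)

attribute [instance] AdaptedProcess.mΩ AdaptedProcess.isProb

/-- Constructions of adapted functionals: bounded continuous functions of finitely many marginals,
bounded continuous functions of finitely many adapted functionals, conditional expectations. -/
inductive AdaptedFunctional (T : ℕ) (U : Type u) [TopologicalSpace U] : Type u
  | marginal {n : ℕ} (t : Fin n → Fin (T + 1)) (f : (Fin n → U) →ᵇ ℝ) : AdaptedFunctional T U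
  | comp {n : ℕ} (g : (Fin n → ℝ) →ᵇ ℝ) (f : Fin n → AdaptedFunctional T U) :
      AdaptedFunctional T U
  | condExp (t : Fin (T + 1)) (f : AdaptedFunctional T U) : AdaptedFunctional T U

/-- The number of nested conditional expectations. -/
def AdaptedFunctional.rank {T : ℕ} {U : Type u} [TopologicalSpace U] :
    AdaptedFunctional T U → ℕ
  | .marginal _ _ => 0
  | .comp _ f => Finset.univ.sup fun i => (f i).rank
  | .condExp _ f => f.rank + 1

/-- The random variable `f(𝐗)` (a version of it, as conditional expectations are only defined
almost surely). -/
def AdaptedFunctional.eval {T : ℕ} {U : Type u} [TopologicalSpace U] [MeasurableSpace U]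
    (X : AdaptedProcess.{u, w} T U) : AdaptedFunctional T U → X.Ω → ℝ
  | .marginal t f => fun ω => f fun i => X.X (t i) ω
  | .comp g f => fun ω => g fun i => (f i).eval X ω
  | .condExp t f => MeasureTheory.condExp (X.ℱ t) X.P (f.eval X)

/-- `E[f(𝐗)]`. -/
def AdaptedFunctional.expect {T : ℕ} {U : Type u} [TopologicalSpace U] [MeasurableSpace U]
    (f : AdaptedFunctional T U) (X : AdaptedProcess.{u, w} T U) : ℝ :=
  ∫ ω, f.eval X ω ∂X.P

/-- `AF_r`, the adapted functionals of rank at most `r`. -/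
def AF (T : ℕ) (U : Type u) [TopologicalSpace U] (r : ℕ) : Set (AdaptedFunctional T U) :=
  {f | f.rank ≤ r}

/-- The adapted topology `τ_r`: the coarsest topology on processes making `𝐗 ↦ E[f(𝐗)]`
continuous for all `f ∈ AF_r`. -/
@[reducible] def tau (T : ℕ) (U : Type u) [TopologicalSpace U] [MeasurableSpace U] (r : ℕ) :
    TopologicalSpace (AdaptedProcess.{u, w} T U) :=
  ⨅ f ∈ AF T U r, TopologicalSpace.induced (fun X => f.expect X) inferInstance

/-! ### Measures of rank `r` and prediction processes -/

/-- A topological space with its Borel σ-algebra. -/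
structure BorelSp : Type (u + 1) where
  carrier : Type u
  [top : TopologicalSpace carrier]
  [meas : MeasurableSpace carrier]
  [borel : BorelSpace carrier]

attribute [instance] BorelSp.top BorelSp.meas BorelSp.borel

/-- The paths `I → X`, with the product topology. -/
def BorelSp.path (T : ℕ) (X : BorelSp.{u}) : BorelSp.{u} where
  carrier := Fin (T + 1) → X.carrier
  top := Pi.topologicalSpace
  meas := _root_.borel _
  borel := @BorelSpace.mk _ _ (_root_.borel _) rfl

/-- The Borel probability measures on `X`, with the topology of weak convergence. -/
def BorelSp.prob (X : BorelSp.{u}) : BorelSp.{u} where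
  carrier := ProbabilityMeasure X.carrier
  meas := _root_.borel _
  borel := @BorelSpace.mk _ _ (_root_.borel _) rfl

/-- The underlying measure of a point of `X.prob`. -/
def BorelSp.measureOf {X : BorelSp.{u}} (μ : X.prob.carrier) : Measure X.carrier :=
  ProbabilityMeasure.toMeasure (Ω := X.carrier) μ

/-- The rank `r` probability measures: `Prob_0 = U`, `Prob_{r+1} = Prob(I → Prob_r)`. -/
def probRank (T : ℕ) (U : BorelSp.{u}) : ℕ → BorelSp.{u}
  | 0 => U
  | r + 1 => ((probRank T U r).path T).prob

section Prediction

variable {T : ℕ} {U : Type u} [MeasurableSpace U]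

/-- `Y` is (a version of) the prediction process `Y_t = P(Z ∈ · | ℱ_t)` of the random variable `Z`:
`Y_t` is a regular conditional distribution of `Z` given `ℱ_t`. -/
structure IsPrediction (X : AdaptedProcess.{u, w} T U) {A : BorelSp.{u}} (Z : X.Ω → A.carrier)
    (Y : X.Ω → (A.prob.path T).carrier) : Prop where
  measurable : Measurable Y
  adapted : ∀ t, Measurable[X.ℱ t] fun ω => Y ω t
  condLaw : ∀ t, ∀ B : Set A.carrier, MeasurableSet B →
    (fun ω => (BorelSp.measureOf (Y ω t)).real B)
      =ᵐ[X.P] MeasureTheory.condExp (X.ℱ t) X.P ((Z ⁻¹' B).indicator fun _ => (1 : ℝ))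

open Classical in
/-- The prediction process of `Z`, in a chosen version. The last value is never used when `A` is
Polish, since regular conditional distributions then exist. -/
def predict (X : AdaptedProcess.{u, w} T U) {A : BorelSp.{u}}
    (Z : {Z : X.Ω → A.carrier // Measurable Z}) :
    {Y : X.Ω → (A.prob.path T).carrier // Measurable Y} :=
  if h : ∃ Y, IsPrediction X Z.1 Y then ⟨h.choose, h.choose_spec.measurable⟩
  else ⟨fun _ _ => (⟨Measure.dirac (Z.1 X.P.nonempty_of_neZero.some),
    Measure.dirac.isProbabilityMeasure⟩ : ProbabilityMeasure A.carrier), measurable_const⟩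

variable [TopologicalSpace U] [SecondCountableTopology U] [BorelSpace U]

/-- The state space as a bundled Borel space. -/
def BorelSp.of (U : Type u) [TopologicalSpace U] [MeasurableSpace U] [BorelSpace U] :
    BorelSp.{u} where
  carrier := U

theorem AdaptedProcess.measurable_path (X : AdaptedProcess.{u, w} T U) :
    @Measurable X.Ω ((BorelSp.of U).path T).carrier X.mΩ ((BorelSp.of U).path T).meas
      fun ω t => X.X t ω := by
  have h : Measurable fun ω => (fun t => X.X t ω : Fin (T + 1) → U) :=
    measurable_pi_lambda _ fun t => (X.adapted t).mono (X.ℱ.le t) le_rfl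
  have e : (MeasurableSpace.pi : MeasurableSpace (Fin (T + 1) → U)) = borel _ :=
    BorelSpace.measurable_eq
  rw [e] at h
  exact h

/-- The rank `r` prediction process `X̂^r`, as a random path in `Prob_r(U)`:
`X̂^0 = X` and `X̂^{r+1}_t = P(X̂^r ∈ · | ℱ_t)`. -/
def AdaptedProcess.prediction (X : AdaptedProcess.{u, w} T U) : (r : ℕ) →
    {Z : X.Ω → ((probRank T (BorelSp.of U) r).path T).carrier // Measurable Z}
  | 0 => ⟨fun ω t => X.X t ω, X.measurable_path⟩
  | r + 1 => predict X (X.prediction r)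

/-- `Law(X̂^r) ∈ Prob_{r+1}(U) = Prob(I → Prob_r(U))`. -/
def AdaptedProcess.lawPrediction (X : AdaptedProcess.{u, w} T U) (r : ℕ) :
    (probRank T (BorelSp.of U) (r + 1)).carrier :=
  (⟨X.P.map (X.prediction r).1,
    Measure.isProbabilityMeasure_map (X.prediction r).2.aemeasurable⟩ :
    ProbabilityMeasure ((probRank T (BorelSp.of U) r).path T).carrier)

end Prediction

/-- The extended weak topology `τ̂_r`: weak convergence of the laws of the rank `r` prediction
processes. -/
@[reducible] def tauHat (T : ℕ) (U : Type u) [TopologicalSpace U] [SecondCountableTopology U]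
    [MeasurableSpace U] [BorelSpace U] (r : ℕ) : TopologicalSpace (AdaptedProcess.{u, w} T U) :=
  TopologicalSpace.induced (fun X => X.lawPrediction r) inferInstance

/-! ### Tensor norms and the completed tensor algebra -/

/-- The tensor product `W^{⊗m} × W^{⊗n} → W^{⊗(m+n)}`. -/
def tpMul {W : Type u} [AddCommGroup W] [Module ℝ W] {m n : ℕ} (s : ⨂[ℝ]^m W) (t : ⨂[ℝ]^n W) :
    ⨂[ℝ]^(m + n) W :=
  GradedMonoid.GMul.mul (A := fun i => ⨂[ℝ]^i W) s t

/-- The unit `1 ∈ W^{⊗0} = ℝ`. -/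
def tpOne (W : Type u) [AddCommGroup W] [Module ℝ W] : ⨂[ℝ]^0 W :=
  GradedMonoid.GOne.one (A := fun i => ⨂[ℝ]^i W)

/-- Admissible norms on the tensor powers of `W`: on each `W^{⊗m}` a reasonable crossnorm, and
submultiplicative across degrees. Together `tprod_le` and `dual_le` give
`‖v₁ ⊗ ⋯ ⊗ vₘ‖ = ∏ ‖vᵢ‖` (so the norms are permutation invariant on elementary tensors), and
`dual_le` makes the seminorms norms. The projective and the injective norms are examples. -/
structure AdmissibleNorm (W : Type u) [NormedAddCommGroup W] [NormedSpace ℝ W] where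
  nrm : ∀ m : ℕ, Seminorm ℝ (⨂[ℝ]^m W)
  tprod_le : ∀ (m : ℕ) (v : Fin m → W), nrm m (PiTensorProduct.tprod ℝ v) ≤ ∏ i, ‖v i‖
  mul_le : ∀ (m n : ℕ) (s : ⨂[ℝ]^m W) (t : ⨂[ℝ]^n W),
    nrm (m + n) (tpMul s t) ≤ nrm m s * nrm n t
  dual_le : ∀ (m : ℕ) (ℓ : Fin m → (W →L[ℝ] ℝ)) (t : ⨂[ℝ]^m W),
    |PiTensorProduct.lift ((MultilinearMap.mkPiAlgebra ℝ (Fin m) ℝ).compLinearMap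
      fun i => (ℓ i : W →ₗ[ℝ] ℝ)) t| ≤ (∏ i, ‖ℓ i‖) * nrm m t

section TensorAlgebra

variable {W : Type u} [NormedAddCommGroup W] [NormedSpace ℝ W]

/-- `W^{⊗m}` with the norm chosen by `α`. -/
def TPow (_α : AdmissibleNorm W) (m : ℕ) : Type u := ⨂[ℝ]^m W

instance (α : AdmissibleNorm W) (m : ℕ) : AddCommGroup (TPow α m) :=
  inferInstanceAs (AddCommGroup (⨂[ℝ]^m W))

instance (α : AdmissibleNorm W) (m : ℕ) : Module ℝ (TPow α m) :=
  inferInstanceAs (Module ℝ (⨂[ℝ]^m W))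

instance (α : AdmissibleNorm W) (m : ℕ) : SeminormedAddCommGroup (TPow α m) :=
  AddGroupSeminorm.toSeminormedAddCommGroup (E := TPow α m) (α.nrm m).toAddGroupSeminorm

instance (α : AdmissibleNorm W) (m : ℕ) : NormedSpace ℝ (TPow α m) where
  norm_smul_le c t := ((α.nrm m).smul' c t).le

/-- The embedding of `W^{⊗m}` into its completion. -/
def TPow.toCompletion (α : AdmissibleNorm W) (m : ℕ) (t : ⨂[ℝ]^m W) :
    UniformSpace.Completion (TPow α m) :=
  UniformSpace.Completion.coe' (α := TPow α m) t

theorem TPow.norm_toCompletion (α : AdmissibleNorm W) (m : ℕ) (t : ⨂[ℝ]^m W) :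
    ‖TPow.toCompletion α m t‖ = α.nrm m t :=
  UniformSpace.Completion.norm_coe (E := TPow α m) t

/-- The completion of `⨁_m W^{⊗m}` under the norm `∑_m ‖π_m t‖`, realized as the space of sequences
`t = (t_m)` with `t_m` in the completion of `W^{⊗m}` and `∑_m ‖t_m‖ < ∞`. -/
abbrev TAlg (α : AdmissibleNorm W) : Type u :=
  lp (fun m : ℕ => UniformSpace.Completion (TPow α m)) 1

/-- Formal series of tensors, `∏_m W^{⊗m}`. -/
abbrev TSeries (W : Type u) [NormedAddCommGroup W] [NormedSpace ℝ W] : Type u :=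
  ∀ m : ℕ, ⨂[ℝ]^m W

/-- The unit `(1, 0, 0, …)`. -/
def tone : TSeries W := Pi.single 0 (tpOne W)

/-- The tensor convolution product, `(s · t)_m = ∑_{i ≤ m} s_i ⊗ t_{m-i}`. -/
def tmul (s t : TSeries W) : TSeries W := fun m =>
  ∑ i : Fin (m + 1), TensorPower.cast ℝ W (Nat.add_sub_of_le (Nat.le_of_lt_succ i.2))
    (tpMul (s i) (t (m - i)))

/-- The tensor exponential `v ↦ (v^{⊗m} / m!)_m`. -/
def texp (v : W) : TSeries W := fun m =>
  ((Nat.factorial m : ℝ)⁻¹) • PiTensorProduct.tprod ℝ fun _ : Fin m => v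

/-- `ℝ ⊕ W` with the norm `|s| + ‖w‖`. -/
abbrev Aug (W : Type u) : Type u := WithLp 1 (ℝ × W)

/-- The time-augmented increments `Δ_0 x = (1, x(0))`, `Δ_t x = (1, x(t) - x(t-1))`. -/
def incr {T : ℕ} (x : Fin (T + 1) → W) (t : Fin (T + 1)) : Aug W :=
  WithLp.toLp 1 (1, Fin.cases (x 0) (fun s : Fin T => x s.succ - x s.castSucc) t)

/-- The ordered product `∏_{t ∈ I} exp(Δ_t x)` as a formal series. -/
def sigSeries {T : ℕ} (x : Fin (T + 1) → W) : TSeries (Aug W) :=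
  (List.ofFn fun t => texp (incr x t)).foldr tmul tone

theorem AdmissibleNorm.nrm_cast (α : AdmissibleNorm W) {i j : ℕ} (h : i = j) (a : ⨂[ℝ]^i W) :
    α.nrm j (TensorPower.cast ℝ W h a) = α.nrm i a := by
  subst h
  rw [TensorPower.cast_refl, LinearEquiv.refl_apply]

theorem summable_tone (α : AdmissibleNorm W) : Summable fun m => α.nrm m (tone (W := W) m) := by
  refine summable_of_ne_finset_zero (s := {0}) fun m hm => ?_
  rw [tone, Pi.single_eq_of_ne (by simpa using hm), map_zero]

theorem summable_texp (α : AdmissibleNorm W) (v : W) :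
    Summable fun m => α.nrm m (texp v m) := by
  refine Summable.of_nonneg_of_le (fun m => apply_nonneg _ _) (fun m => ?_)
    (Real.summable_pow_div_factorial ‖v‖)
  rw [texp, map_smul_eq_mul, Real.norm_of_nonneg (by positivity), div_eq_inv_mul]
  refine mul_le_mul_of_nonneg_left ((α.tprod_le m _).trans ?_) (by positivity)
  simp

theorem summable_tmul (α : AdmissibleNorm W) {s t : TSeries W}
    (hs : Summable fun m => α.nrm m (s m)) (ht : Summable fun m => α.nrm m (t m)) :
    Summable fun m => α.nrm m (tmul s t m) := by
  have key := (summable_norm_sum_mul_range_of_summable_norm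
    (f := fun m => α.nrm m (s m)) (g := fun m => α.nrm m (t m)) hs.norm ht.norm)
  refine Summable.of_nonneg_of_le (fun m => apply_nonneg _ _) (fun m => ?_) key
  refine le_trans ?_ (le_abs_self _)
  rw [← Fin.sum_univ_eq_sum_range (fun i => α.nrm i (s i) * α.nrm (m - i) (t (m - i)))]
  refine (Finset.le_sum_of_subadditive (α.nrm m) (map_zero _).le (map_add_le_add _) _ _).trans ?_
  refine Finset.sum_le_sum fun i _ => ?_
  rw [α.nrm_cast]
  exact α.mul_le _ _ _ _

theorem summable_sigSeries {T : ℕ} (α : AdmissibleNorm (Aug W)) (x : Fin (T + 1) → W) :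
    Summable fun m => α.nrm m (sigSeries x m) := by
  unfold sigSeries
  generalize hL : List.ofFn (fun t => texp (incr x t)) = L
  have hmem : ∀ s ∈ L, Summable fun m => α.nrm m (s m) := by
    intro s hs
    rw [← hL, List.mem_ofFn] at hs
    obtain ⟨t, rfl⟩ := hs
    exact summable_texp α _
  clear hL
  induction L with
  | nil => exact summable_tone α
  | cons s L ih =>
    exact summable_tmul α (hmem s (by simp)) (ih fun s' h => hmem s' (by simp [h]))

/-- The classical (discrete time, time-augmented) signature `S(x) = ∏_{t ∈ I} exp(Δ_t x)`. -/
def signature {T : ℕ} (α : AdmissibleNorm (Aug W)) (x : Fin (T + 1) → W) : TAlg α :=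
  ⟨fun m => TPow.toCompletion α m (sigSeries x m), by
    refine memℓp_gen ?_
    simp only [ENNReal.toReal_one, Real.rpow_one, TPow.norm_toCompletion]
    exact summable_sigSeries α x⟩

/-- The series with constant term `1`. -/
def unital (α : AdmissibleNorm W) : Set (TAlg α) :=
  {t | t 0 = TPow.toCompletion α 0 (tpOne W)}

/-- A tensor normalization: a bounded, continuous, injective map of the form
`t ↦ δ_{λ(t)} t = (λ(t)^m t_m)_m`, with `λ(t) > 0`, on the series with constant term `1`. -/
structure TensorNormalization (α : AdmissibleNorm W) where
  toFun : TAlg α → TAlg α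
  lam : TAlg α → ℝ
  lam_pos : ∀ t ∈ unital α, 0 < lam t
  apply_eq : ∀ t ∈ unital α, ∀ m : ℕ, toFun t m = lam t ^ m • t m
  continuousOn : ContinuousOn toFun (unital α)
  injOn : Set.InjOn toFun (unital α)
  bounded : ∃ C : ℝ, ∀ t ∈ unital α, ‖toFun t‖ ≤ C

end TensorAlgebra

/-! ### Higher rank tensor algebras and expected signatures -/

/-- A choice of admissible tensor norms for all normed spaces. -/
abbrev TensorNorms : Type (u + 1) :=
  ∀ (W : Type u) [NormedAddCommGroup W] [NormedSpace ℝ W], AdmissibleNorm W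

/-- A choice of tensor normalizations for all normed spaces. -/
abbrev TensorNormalizations (α : TensorNorms.{u}) : Type (u + 1) :=
  ∀ (W : Type u) [NormedAddCommGroup W] [NormedSpace ℝ W], TensorNormalization (α W)

/-- A bundled real normed space. -/
structure NormedSp : Type (u + 1) where
  carrier : Type u
  [grp : NormedAddCommGroup carrier]
  [spc : NormedSpace ℝ carrier]

attribute [instance] NormedSp.grp NormedSp.spc

/-- The rank `r` tensor algebra: `T^0(V) = V`, and `T^{r+1}(V)` is the completion of
`⨁_m (ℝ ⊕ T^r(V))^{⊗m}`. -/
def TRank (α : TensorNorms.{u}) (V : Type u) [NormedAddCommGroup V] [NormedSpace ℝ V] :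
    ℕ → NormedSp.{u}
  | 0 => ⟨V⟩
  | r + 1 => ⟨TAlg (α (Aug (TRank α V r).carrier))⟩

/-- Maps that send paths `I → W` in any normed space `W` to the completed tensor algebra over
`ℝ ⊕ W`. -/
abbrev PathFeature (α : TensorNorms.{u}) (T : ℕ) : Type (u + 1) :=
  ∀ (W : Type u) [NormedAddCommGroup W] [NormedSpace ℝ W], (Fin (T + 1) → W) → TAlg (α (Aug W))

/-- The classical signature `S`. -/
def classicalSig (α : TensorNorms.{u}) (T : ℕ) : PathFeature α T :=
  fun W _ _ x => signature (α (Aug W)) x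

/-- The robust signature `Λ ∘ S`. -/
def robustSig (α : TensorNorms.{u}) (Λ : TensorNormalizations α) (T : ℕ) : PathFeature α T :=
  fun W _ _ x => (Λ (Aug W)).toFun (signature (α (Aug W)) x)

/-- The rank `r` expected signature `Prob_r(U) → T^r(V)` built from the signature `F`, for a state
space `U` embedded in `V` by `ι`: the embedding for `r = 0`, and
`μ ↦ ∫ F(t ↦ expSig_r (x t)) μ(dx)` for `r + 1`. -/
def expSig {α : TensorNorms.{u}} {T : ℕ} (F : PathFeature α T) {U : Type u} [TopologicalSpace U]
    [MeasurableSpace U] [BorelSpace U] {V : Type u} [NormedAddCommGroup V] [NormedSpace ℝ V]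
    (ι : U → V) : (r : ℕ) → (probRank T (BorelSp.of U) r).carrier → (TRank α V r).carrier
  | 0 => ι
  | r + 1 => fun μ => ∫ x : ((probRank T (BorelSp.of U) r).path T).carrier,
      F (TRank α V r).carrier (fun t => expSig F ι r (x t)) ∂BorelSp.measureOf μ

section Phi

variable {α : TensorNorms.{u}} {T : ℕ} (F : PathFeature α T) {U : Type u} [TopologicalSpace U]
  [SecondCountableTopology U] [MeasurableSpace U] [BorelSpace U] {V : Type u}
  [NormedAddCommGroup V] [NormedSpace ℝ V] (ι : U → V) (r : ℕ)

/-- `Φ_r(𝐗)`, the rank `r + 1` expected signature of `Law(X̂^r)`. -/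
def Phi (X : AdaptedProcess.{u, w} T U) : (TRank α V (r + 1)).carrier :=
  expSig F ι (r + 1) (X.lawPrediction r)

/-- The semimetric `d_r(𝐗, 𝐘) = ‖Φ_r(𝐗) - Φ_r(𝐘)‖`. -/
def sigDist (X Y : AdaptedProcess.{u, w} T U) : ℝ :=
  ‖Phi F ι r X - Phi F ι r Y‖

end Phi

/-- The topology of a semimetric `d`: a set is open iff with each of its points it contains a
`d`-ball around it. -/
@[reducible] def semimetricTopology {E : Type*} (d : E → E → ℝ) : TopologicalSpace E where
  IsOpen s := ∀ x ∈ s, ∃ ε > 0, ∀ y, d x y < ε → y ∈ s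
  isOpen_univ := fun _ _ => ⟨1, one_pos, fun _ _ => trivial⟩
  isOpen_inter := fun s t hs ht x hx => by
    obtain ⟨ε, hε, h⟩ := hs x hx.1
    obtain ⟨δ, hδ, h'⟩ := ht x hx.2
    exact ⟨min ε δ, lt_min hε hδ, fun y hy =>
      ⟨h y (hy.trans_le (min_le_left _ _)), h' y (hy.trans_le (min_le_right _ _))⟩⟩
  isOpen_sUnion := fun S hS x hx => by
    obtain ⟨s, hs, hxs⟩ := hx
    obtain ⟨ε, hε, h⟩ := hS s hs x hxs
    exact ⟨ε, hε, fun y hy => ⟨s, hs, h y hy⟩⟩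

end AdaptedSig

end

noncomputable section

namespace AdaptedSig

open Filter Set
open scoped ENNReal NNReal

/-! Write `L(𝐗) = Law(X̂^r)`, a point of the Polish space `Prob_{r+1}(U)`. Every object in the
theorem is a function of `L`, and the proof exhibits two continuous injections on `Prob_{r+1}(U)`.

The first one collects expectations of adapted functionals. By induction on the construction, every
functional in `AF_r` is a bounded continuous function of the path `X̂^r` (`exists_represents`). The
functions that arise in this way form a point-separating algebra (`representableAlgebra_separates`),
so over a Polish space their integrals determine the law. Thus `τ_r` is the initial topology of `q ∘
L` with `q` continuous and injective (`tau_eq_induced`, `injective_representableIntegrals`).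

The second one is the expected signature: `Φ_r = Ψ ∘ L`, where `Ψ` is the rank `r + 1` expected
signature. Coordinates of signatures satisfy the shuffle identity, so their linear span is an
algebra; the time component makes it separate paths (`path_eq_of_wordEval_eq`). Hence the
expectation of a bounded signature determines the measure (`injective_integral_of_isGroupLike`), and
as a Bochner integral it is norm continuous in the measure for the weak topology
(`continuous_integral_of_norm_le`). Iterating over the ranks makes `Ψ` continuous and injective
(`continuous_injective_expSig`).

Injectivity of `q` and `Ψ` turns both sides of the equivalence into `L(𝐗) = L(𝐘)`. A continuous
injection of a compact space into a Hausdorff space is an embedding, so where `L` takes values in a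
compact set, `q ∘ L`, `Ψ ∘ L` and `L` induce the same topology (`topologies_eq_of_isCompact`). For
compact `K` the whole space `Prob_{r+1}(K)` is compact, which removes the localization and also
bounds the classical signature.

Polishness of all spaces `Prob_k(U)` is needed for regular conditional distributions and for the
separation argument; the first part provides it. -/

/-! ### The space of probability measures on a Polish space -/

section ProbabilityMeasure

/-- Push-forward along a topological embedding induces the weak topology. -/
theorem isInducing_probabilityMeasure_map {X Y : Type*} [TopologicalSpace X]
    [TopologicalSpace.MetrizableSpace X] [TopologicalSpace.SeparableSpace X] [MeasurableSpace X]
    [BorelSpace X] [TopologicalSpace Y] [TopologicalSpace.MetrizableSpace Y]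
    [TopologicalSpace.SeparableSpace Y] [MeasurableSpace Y] [BorelSpace Y]
    {j : X → Y} (hj : IsEmbedding j) :
    IsInducing fun μ : ProbabilityMeasure X => μ.map hj.continuous.measurable.aemeasurable := by
  have hcont := ProbabilityMeasure.continuous_map hj.continuous
  rw [isInducing_iff_nhds]
  intro μ
  refine le_antisymm (map_le_iff_le_comap.1 (hcont.tendsto μ)) ?_
  -- It remains to show that the identity tends to `μ` along the pulled-back filter. By the
  -- portmanteau theorem open sets suffice, and these are traces of open sets of `Y`, where
  -- convergence holds by the choice of the filter.
  refine tendsto_id'.1 ?_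
  let := TopologicalSpace.metrizableSpaceMetric X
  let := TopologicalSpace.metrizableSpaceMetric Y
  refine tendsto_of_forall_isOpen_le_liminf' fun G hG => ?_
  obtain ⟨G', hG', rfl⟩ := hj.isInducing.isOpen_iff.1 hG
  have key := ProbabilityMeasure.le_liminf_measure_open_of_tendsto
    (tendsto_comap (f := fun μ : ProbabilityMeasure X =>
      μ.map hj.continuous.measurable.aemeasurable)
      (x := 𝓝 (μ.map hj.continuous.measurable.aemeasurable))) hG'
  have e : ∀ ν : ProbabilityMeasure X,
      (ν.map hj.continuous.measurable.aemeasurable : Measure Y) G' = (ν : Measure X) (j ⁻¹' G') :=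
    fun ν => by
      rw [ProbabilityMeasure.toMeasure_map, Measure.map_apply hj.continuous.measurable
        hG'.measurableSet]
  simpa only [e, id] using key

/-- `X` embeds into the Hilbert cube, whose probability measures form a compact metrizable space.
Second countability pulls back along push-forward. -/
instance secondCountable_probabilityMeasure {X : Type*} [TopologicalSpace X]
    [TopologicalSpace.MetrizableSpace X] [TopologicalSpace.SeparableSpace X] [MeasurableSpace X]
    [BorelSpace X] : SecondCountableTopology (ProbabilityMeasure X) := by
  let := TopologicalSpace.metrizableSpaceMetric X
  obtain ⟨F, hF⟩ := Metric.PiNatEmbed.exists_embedding_to_hilbert_cube (X := X)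
  have : SecondCountableTopology (ProbabilityMeasure (ℕ → unitInterval)) := by
    let := TopologicalSpace.metrizableSpaceMetric (ProbabilityMeasure (ℕ → unitInterval))
    infer_instance
  exact (isInducing_probabilityMeasure_map hF).secondCountableTopology

/-- A Cauchy sequence for the Lévy–Prokhorov metric over a complete separable space is tight. -/
theorem isTightMeasureSet_range_of_cauchySeq {X : Type*} [MetricSpace X] [CompleteSpace X]
    [SecondCountableTopology X] [MeasurableSpace X] [BorelSpace X]
    {μ : ℕ → LevyProkhorov (ProbabilityMeasure X)} (hμ : CauchySeq μ) :
    IsTightMeasureSet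
      {((ν : ProbabilityMeasure X) : Measure X) | ν ∈ range fun n => (μ n).toMeasure} := by
  rw [isTightMeasureSet_iff_exists_isCompact_measure_compl_le]
  intro ε hε
  obtain ⟨δ, hδ, hδs⟩ := ENNReal.exists_pos_sum_of_countable' hε.ne' ℕ
  -- At scale `1 / (m + 1)` finitely many measures are tight on one compact set, and all later ones
  -- are Lévy–Prokhorov close to the last of these, hence carry almost the same mass on a thickening
  -- of that set.
  have hstep : ∀ (m : ℕ), ∃ K : Set X, IsCompact K ∧
      ∀ n, ((μ n).toMeasure : Measure X) (Metric.thickening (1 / ((m : ℝ) + 1)) K)ᶜ ≤ δ m := by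
    intro m
    have hδm : δ m ≠ ∞ := ((ENNReal.le_tsum m).trans_lt (hδs.trans_le le_top)).ne
    -- A Lévy–Prokhorov distance below `η` bounds both the thickening radius and the lost mass. The
    -- other half of `δ m` pays for the tightness of the first `N + 1` measures.
    obtain ⟨η, hη, hη1, hη2⟩ : ∃ η : ℝ, 0 < η ∧ η ≤ 1 / ((m : ℝ) + 1) ∧
        ENNReal.ofReal η ≤ δ m / 2 := by
      have h2 : 0 < (δ m / 2).toReal := ENNReal.toReal_pos
        (ENNReal.div_pos (hδ m).ne' (by simp)).ne' (ENNReal.div_ne_top hδm (by simp))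
      refine ⟨min (1 / ((m : ℝ) + 1)) (δ m / 2).toReal, lt_min (by positivity) h2,
        min_le_left _ _, ?_⟩
      refine (ENNReal.ofReal_le_ofReal (min_le_right _ _)).trans ?_
      exact ENNReal.ofReal_toReal_le
    obtain ⟨N, hN⟩ := Metric.cauchySeq_iff'.1 hμ η hη
    have hpos : 0 < δ m / 2 := ENNReal.div_pos (hδ m).ne' (by simp)
    have hsing : ∀ i : ℕ, ∃ K : Set X, IsCompact K ∧
        ((μ i).toMeasure : Measure X) Kᶜ ≤ δ m / 2 := fun i => by
      obtain ⟨K, hK, h⟩ := isTightMeasureSet_iff_exists_isCompact_measure_compl_le.1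
        (isTightMeasureSet_singleton (μ := ((μ i).toMeasure : Measure X))) (δ m / 2) hpos
      exact ⟨K, hK, h _ rfl⟩
    choose C hC hCm using hsing
    set K := ⋃ i ∈ Iic N, C i with hKdef
    have hK : IsCompact K := (finite_Iic N).isCompact_biUnion fun i _ => hC i
    have hKle : ∀ i ≤ N, ((μ i).toMeasure : Measure X) Kᶜ ≤ δ m / 2 := fun i hi =>
      (measure_mono (compl_subset_compl.2 (subset_biUnion_of_mem (u := C) (mem_Iic.2 hi)))).trans
        (hCm i)
    have hsub : K ⊆ Metric.thickening (1 / ((m : ℝ) + 1)) K :=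
      Metric.self_subset_thickening (by positivity) K
    refine ⟨K, hK, fun n => ?_⟩
    rcases le_total n N with hn | hn
    · exact (measure_mono (compl_subset_compl.2 hsub)).trans
        ((hKle n hn).trans ENNReal.half_le_self)
    · have hdist : levyProkhorovEDist ((μ N).toMeasure : Measure X) ((μ n).toMeasure : Measure X)
          < ENNReal.ofReal η := by
        have h1 := hN n hn
        rw [dist_comm, dist_edist] at h1
        rw [← LevyProkhorov.edist_probabilityMeasure_def]
        exact (ENNReal.lt_ofReal_iff_toReal_lt (edist_ne_top _ _)).2 h1
      have h2 := left_measure_le_of_levyProkhorovEDist_lt hdist hK.isClosed.measurableSet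
      rw [ENNReal.toReal_ofReal hη.le] at h2
      have h3 : ((μ N).toMeasure : Measure X) K ≤
          ((μ n).toMeasure : Measure X) (Metric.thickening (1 / ((m : ℝ) + 1)) K) + δ m / 2 :=
        h2.trans (add_le_add (measure_mono (Metric.thickening_mono hη1 K)) hη2)
      have h4 := hKle N le_rfl
      rw [prob_compl_eq_one_sub Metric.isOpen_thickening.measurableSet, tsub_le_iff_right]
      rw [prob_compl_eq_one_sub hK.isClosed.measurableSet, tsub_le_iff_right] at h4
      calc (1 : ℝ≥0∞) ≤ δ m / 2 + ((μ N).toMeasure : Measure X) K := h4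
        _ ≤ δ m / 2 + (((μ n).toMeasure : Measure X)
            (Metric.thickening (1 / ((m : ℝ) + 1)) K) + δ m / 2) := by gcongr
        _ = δ m / 2 + δ m / 2 + ((μ n).toMeasure : Measure X)
            (Metric.thickening (1 / ((m : ℝ) + 1)) K) := by ring
        _ = _ := by rw [ENNReal.add_halves]
  choose K hK hKm using hstep
  -- The intersection is closed, and totally bounded because at every scale it lies near a compact
  -- set.
  refine ⟨⋂ m : ℕ, Metric.cthickening (1 / ((m : ℝ) + 1)) (K m), ?_, ?_⟩
  · refine TotallyBounded.isCompact_of_isClosed ?_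
      (isClosed_iInter fun m => Metric.isClosed_cthickening)
    rw [Metric.totallyBounded_iff]
    intro r hr
    obtain ⟨m, hm⟩ := exists_nat_one_div_lt (half_pos hr)
    obtain ⟨t, ht, htK⟩ := Metric.totallyBounded_iff.1 (hK m).totallyBounded (r / 2) (half_pos hr)
    refine ⟨t, ht, fun x hx => ?_⟩
    have hx' := Metric.cthickening_subset_thickening' (half_pos hr) hm (K m) (mem_iInter.1 hx m)
    obtain ⟨z, hz, hxz⟩ := Metric.mem_thickening_iff.1 hx'
    obtain ⟨y, hy, hzy⟩ := mem_iUnion₂.1 (htK hz)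
    refine mem_iUnion₂.2 ⟨y, hy, ?_⟩
    have h1 : dist z y < r / 2 := hzy
    have := dist_triangle x z y
    exact Metric.mem_ball.2 (by linarith)
  · rintro _ ⟨_, ⟨n, rfl⟩, rfl⟩
    rw [compl_iInter]
    refine (measure_iUnion_le _).trans ((ENNReal.tsum_le_tsum fun m => ?_).trans hδs.le)
    exact (measure_mono (compl_subset_compl.2
      (Metric.thickening_subset_cthickening _ _))).trans (hKm m n)

/-- The Lévy–Prokhorov metric is complete: a Cauchy sequence is tight, hence by Prokhorov's theorem
stays in a compact set, where it converges. -/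
instance polish_probabilityMeasure {X : Type*} [TopologicalSpace X] [PolishSpace X]
    [MeasurableSpace X] [BorelSpace X] : PolishSpace (ProbabilityMeasure X) := by
  let := TopologicalSpace.upgradeIsCompletelyMetrizable X
  let e := LevyProkhorov.probabilityMeasureHomeomorph (Ω := X)
  have : SecondCountableTopology (LevyProkhorov (ProbabilityMeasure X)) :=
    e.symm.isInducing.secondCountableTopology
  have : CompleteSpace (LevyProkhorov (ProbabilityMeasure X)) := by
    refine Metric.complete_of_cauchySeq_tendsto fun μ hμ => ?_
    have hc := isCompact_closure_of_isTightMeasureSet (isTightMeasureSet_range_of_cauchySeq hμ)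
    obtain ⟨ν, -, hν⟩ := cauchySeq_tendsto_of_isComplete (hc.image e.continuous).isComplete
      (u := μ) (fun n => ⟨_, subset_closure ⟨n, rfl⟩, rfl⟩) hμ
    exact ⟨ν, hν⟩
  exact e.isClosedEmbedding.polishSpace

/-- On the probability measures over a separable metrizable space, the Borel σ-algebra of the weak
topology is generated by the evaluations at measurable sets. -/
theorem borel_probabilityMeasure {X : Type*} [TopologicalSpace X]
    [TopologicalSpace.MetrizableSpace X] [TopologicalSpace.SeparableSpace X] [MeasurableSpace X]
    [BorelSpace X] :
    (inferInstance : MeasurableSpace (ProbabilityMeasure X)) = borel (ProbabilityMeasure X) := by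
  refine le_antisymm ?_ ?_
  · let := TopologicalSpace.metrizableSpaceMetric X
    have hm : @Measurable _ _ (borel (ProbabilityMeasure X)) _
        fun μ : ProbabilityMeasure X => (μ : Measure X) := by
      let : MeasurableSpace (ProbabilityMeasure X) := borel _
      have : BorelSpace (ProbabilityMeasure X) := ⟨rfl⟩
      -- Open sets are a generating π-system, and `μ ↦ μ G` is lower semicontinuous for open `G`.
      refine Measurable.measure_of_isPiSystem_of_isProbabilityMeasure
        (BorelSpace.measurable_eq (α := X)) isPiSystem_isOpen fun G hG => ?_
      refine LowerSemicontinuous.measurable fun μ y hy => ?_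
      exact eventually_lt_of_lt_liminf (lt_of_lt_of_le hy
        (ProbabilityMeasure.le_liminf_measure_open_of_tendsto tendsto_id hG))
    exact measurable_iff_comap_le.1 hm
  · have e : (inferInstance : TopologicalSpace (ProbabilityMeasure X)) =
        TopologicalSpace.induced
          (fun (μ : ProbabilityMeasure X) (f : X →ᵇ ℝ) => ∫ x, f x ∂(μ : Measure X))
          inferInstance := by
      refine (IsInducing.eq_induced (isInducing_iff_nhds.2 fun μ => le_antisymm ?_ ?_))
      · refine map_le_iff_le_comap.1 (Continuous.tendsto ?_ μ)
        exact continuous_pi fun f =>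
          ProbabilityMeasure.continuous_integral_boundedContinuousFunction f
      · refine tendsto_id'.1 (ProbabilityMeasure.tendsto_iff_forall_integral_tendsto.2 fun f => ?_)
        exact ((continuous_apply (A := fun _ : X →ᵇ ℝ => ℝ) f).tendsto _).comp tendsto_comap
    -- Preimages under the integrals of bounded continuous functions form a subbasis. By second
    -- countability they generate the Borel σ-algebra, so it is enough that each such integral is
    -- measurable for the evaluations.
    have e' : (inferInstance : TopologicalSpace (ProbabilityMeasure X)) =
        TopologicalSpace.generateFrom (⋃ f : X →ᵇ ℝ,
          {s | ∃ t : Set ℝ, IsOpen t ∧ (fun μ : ProbabilityMeasure X =>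
            ∫ x, f x ∂(μ : Measure X)) ⁻¹' t = s}) := by
      rw [e, Pi.topologicalSpace, induced_iInf, generateFrom_iUnion]
      refine iInf_congr fun f => ?_
      rw [induced_compose]
      exact (TopologicalSpace.generateFrom_setOfPred_isOpen _).symm
    rw [borel_eq_generateFrom_of_subbasis e']
    refine MeasurableSpace.generateFrom_le fun s hs => ?_
    obtain ⟨f, t, ht, rfl⟩ := mem_iUnion.1 hs
    let κ : ProbabilityTheory.Kernel (ProbabilityMeasure X) X :=
      ⟨fun μ => (μ : Measure X), measurable_subtype_coe⟩
    have : Measurable fun μ : ProbabilityMeasure X => ∫ x, f x ∂(μ : Measure X) :=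
      (StronglyMeasurable.integral_kernel (κ := κ)
        f.continuous.stronglyMeasurable).measurable
    exact this ht.measurableSet

end ProbabilityMeasure

/-! ### Weak continuity of vector valued integrals, Dirac measures -/

/-- The integral of a bounded continuous Banach space valued function depends continuously on the
measure, in the norm topology. -/
theorem continuous_integral_of_norm_le {X E : Type*} [TopologicalSpace X]
    [SecondCountableTopology X] [MeasurableSpace X] [OpensMeasurableSpace X]
    [NormedAddCommGroup E] [NormedSpace ℝ E] [CompleteSpace E] {G : X → E} (hG : Continuous G)
    {M : ℝ} (hM : ∀ x, ‖G x‖ ≤ M) :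
    Continuous fun μ : ProbabilityMeasure X => ∫ x, G x ∂(μ : Measure X) := by
  refine continuous_iff_continuousAt.2 fun μ => Metric.continuousAt_iff'.2 fun η hη => ?_
  obtain ⟨x₀⟩ := μ.nonempty
  have hX : Nonempty X := ⟨x₀⟩
  have hM0 : 0 ≤ M := (norm_nonneg _).trans (hM x₀)
  -- The errors below add up to `(2 * M + 3) * ε`, strictly less than `η`.
  set ε : ℝ := η / (2 * M + 4) with hεdef
  have hε : 0 < ε := by positivity
  -- The bumps `g i` live where `G` is `ε`-close to `y i`. Normalized as `ψ i`, they form with the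
  -- remainder `ρ N` a partition of unity; `δ N` keeps the denominator positive. Replacing `G` by `H
  -- = ∑ ψ i • y i` leaves finitely many scalar integrals, continuous in the measure. The error is
  -- at most `ε + M * ρ N`, and `∫ ρ N < ε` is an open condition on the measure, which holds at `μ`
  -- for some `N` by dominated convergence.
  let y : ℕ → E := fun i => G (TopologicalSpace.denseSeq X i)
  let g : ℕ → X → ℝ := fun i x => max 0 (ε - ‖G x - y i‖)
  have hg0 : ∀ i x, 0 ≤ g i x := fun i x => le_max_left _ _
  have hgc : ∀ i, Continuous (g i) := fun i =>
    continuous_const.max (continuous_const.sub (hG.sub continuous_const).norm)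
  let s : ℕ → X → ℝ := fun N x => ∑ i ∈ Finset.range N, g i x
  have hs0 : ∀ N x, 0 ≤ s N x := fun N x => Finset.sum_nonneg fun i _ => hg0 i x
  have hsc : ∀ N, Continuous (s N) := fun N => continuous_finsetSum _ fun i _ => hgc i
  let δ : ℕ → ℝ := fun N => 1 / ((N : ℝ) + 1)
  have hδ : ∀ N, 0 < δ N := fun N => by positivity
  have hden : ∀ N x, 0 < δ N + s N x := fun N x => by linarith [hδ N, hs0 N x]
  let ρ : ℕ → X → ℝ := fun N x => δ N / (δ N + s N x)
  have hρc : ∀ N, Continuous (ρ N) := fun N =>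
    continuous_const.div (continuous_const.add (hsc N)) fun x => (hden N x).ne'
  have hρ0 : ∀ N x, 0 ≤ ρ N x := fun N x => div_nonneg (hδ N).le (hden N x).le
  have hρ1 : ∀ N x, ρ N x ≤ 1 := fun N x => (div_le_one (hden N x)).2 (by linarith [hs0 N x])
  have hlim : Tendsto (fun N => ∫ x, ρ N x ∂(μ : Measure X)) atTop (𝓝 0) := by
    have : (0 : ℝ) = ∫ _, (0 : ℝ) ∂(μ : Measure X) := by simp
    rw [this]
    refine tendsto_integral_of_dominated_convergence (fun _ => (1 : ℝ))
      (fun N => (hρc N).aestronglyMeasurable) (integrable_const _)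
      (fun N => ae_of_all _ fun x => by rw [Real.norm_of_nonneg (hρ0 N x)]; exact hρ1 N x)
      (ae_of_all _ fun x => ?_)
    obtain ⟨i, hi⟩ : ∃ i, ‖G x - y i‖ < ε := by
      have ho : IsOpen {z | ‖G x - G z‖ < ε} :=
        isOpen_lt (continuous_const.sub hG).norm continuous_const
      obtain ⟨i, hi⟩ := (TopologicalSpace.denseRange_denseSeq X).exists_mem_open ho
        ⟨x, by simpa using hε⟩
      exact ⟨i, hi⟩
    have hgi : 0 < g i x := lt_max_of_lt_right (sub_pos.2 hi)
    have hδ0 : Tendsto δ atTop (𝓝 0) := tendsto_one_div_add_atTop_nhds_zero_nat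
    refine squeeze_zero' (Eventually.of_forall fun N => hρ0 N x) ?_
      (by simpa using hδ0.div_const (g i x))
    filter_upwards [eventually_gt_atTop i] with N hN
    refine div_le_div_of_nonneg_left (hδ N).le hgi ?_
    have : g i x ≤ s N x :=
      Finset.single_le_sum (f := fun i => g i x) (fun j _ => hg0 j x) (Finset.mem_range.2 hN)
    linarith [hδ N]
  obtain ⟨N, hN⟩ := (hlim.eventually (gt_mem_nhds hε)).exists
  let ψ : ℕ → X → ℝ := fun i x => g i x / (δ N + s N x)
  have hψc : ∀ i, Continuous (ψ i) := fun i =>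
    (hgc i).div (continuous_const.add (hsc N)) fun x => (hden N x).ne'
  have hψ0 : ∀ i x, 0 ≤ ψ i x := fun i x => div_nonneg (hg0 i x) (hden N x).le
  have hsum : ∀ x, ρ N x + ∑ i ∈ Finset.range N, ψ i x = 1 := fun x => by
    simp only [ρ, ψ, ← Finset.sum_div, ← add_div]
    exact div_self (hden N x).ne'
  have hψ1 : ∀ i < N, ∀ x, ψ i x ≤ 1 := fun i hi x => by
    have := Finset.single_le_sum (f := fun i => ψ i x) (fun j _ => hψ0 j x)
      (Finset.mem_range.2 hi)
    linarith [hsum x, hρ0 N x]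
  let H : X → E := fun x => ∑ i ∈ Finset.range N, ψ i x • y i
  have hGH : ∀ x, ‖G x - H x‖ ≤ ε + M * ρ N x := fun x => by
    have h1 : G x - H x = ρ N x • G x + ∑ i ∈ Finset.range N, ψ i x • (G x - y i) := by
      simp only [smul_sub, Finset.sum_sub_distrib, ← Finset.sum_smul, H]
      rw [← add_sub_assoc, ← add_smul, hsum, one_smul]
    have h2 : ∀ i ∈ Finset.range N, ‖ψ i x • (G x - y i)‖ ≤ ψ i x * ε := fun i _ => by
      rw [norm_smul, Real.norm_of_nonneg (hψ0 i x)]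
      rcases lt_or_ge ‖G x - y i‖ ε with h | h
      · exact mul_le_mul_of_nonneg_left h.le (hψ0 i x)
      · have : ψ i x = 0 := by
          simp only [ψ, g]
          rw [max_eq_left (by linarith), zero_div]
        simp [this]
    rw [h1]
    calc _ ≤ ‖ρ N x • G x‖ + ∑ i ∈ Finset.range N, ψ i x * ε :=
          (norm_add_le _ _).trans (add_le_add le_rfl (norm_sum_le_of_le _ h2))
      _ ≤ ρ N x * M + 1 * ε := by
          rw [norm_smul, Real.norm_of_nonneg (hρ0 N x), ← Finset.sum_mul]
          refine add_le_add (mul_le_mul_of_nonneg_left (hM x) (hρ0 N x))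
            (mul_le_mul_of_nonneg_right ?_ hε.le)
          linarith [hsum x, hρ0 N x]
      _ = _ := by ring
  have hGi : ∀ ν : ProbabilityMeasure X, Integrable G (ν : Measure X) := fun ν =>
    Integrable.of_bound hG.aestronglyMeasurable M (ae_of_all _ hM)
  have hρi : ∀ ν : ProbabilityMeasure X, Integrable (ρ N) (ν : Measure X) := fun ν =>
    Integrable.of_bound (hρc N).aestronglyMeasurable 1
      (ae_of_all _ fun x => by rw [Real.norm_of_nonneg (hρ0 N x)]; exact hρ1 N x)
  have hψi : ∀ i < N, ∀ ν : ProbabilityMeasure X, Integrable (ψ i) (ν : Measure X) :=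
    fun i hi ν => Integrable.of_bound (hψc i).aestronglyMeasurable 1
      (ae_of_all _ fun x => by rw [Real.norm_of_nonneg (hψ0 i x)]; exact hψ1 i hi x)
  have hHi : ∀ ν : ProbabilityMeasure X, Integrable H (ν : Measure X) := fun ν =>
    integrable_finsetSum _ fun i hi => (hψi i (Finset.mem_range.1 hi) ν).smul_const _
  have hHint : ∀ ν : ProbabilityMeasure X, ∫ x, H x ∂(ν : Measure X) =
      ∑ i ∈ Finset.range N, (∫ x, ψ i x ∂(ν : Measure X)) • y i := fun ν => by
    rw [integral_finsetSum _ fun i hi => (hψi i (Finset.mem_range.1 hi) ν).smul_const _]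
    exact Finset.sum_congr rfl fun i _ => integral_smul_const _ _
  have hψcont : ∀ i < N, Continuous fun ν : ProbabilityMeasure X => ∫ x, ψ i x ∂(ν : Measure X) :=
    fun i hi => ProbabilityMeasure.continuous_integral_boundedContinuousFunction
      (BoundedContinuousFunction.ofNormedAddCommGroup (ψ i) (hψc i) 1
        fun x => by rw [Real.norm_of_nonneg (hψ0 i x)]; exact hψ1 i hi x)
  have hρcont : Continuous fun ν : ProbabilityMeasure X => ∫ x, ρ N x ∂(ν : Measure X) :=
    ProbabilityMeasure.continuous_integral_boundedContinuousFunction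
      (BoundedContinuousFunction.ofNormedAddCommGroup (ρ N) (hρc N) 1
        fun x => by rw [Real.norm_of_nonneg (hρ0 N x)]; exact hρ1 N x)
  have hHcont : Continuous fun ν : ProbabilityMeasure X => ∫ x, H x ∂(ν : Measure X) := by
    simp only [hHint]
    exact continuous_finsetSum _ fun i hi =>
      (hψcont i (Finset.mem_range.1 hi)).smul continuous_const
  have hest : ∀ ν : ProbabilityMeasure X, ∫ x, ρ N x ∂(ν : Measure X) < ε →
      ‖∫ x, G x ∂(ν : Measure X) - ∫ x, H x ∂(ν : Measure X)‖ ≤ ε + M * ε := fun ν hν => by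
    rw [← integral_sub (hGi ν) (hHi ν)]
    calc _ ≤ ∫ x, (ε + M * ρ N x) ∂(ν : Measure X) :=
          norm_integral_le_of_norm_le ((integrable_const _).add ((hρi ν).const_mul M))
            (ae_of_all _ hGH)
      _ = ε + M * ∫ x, ρ N x ∂(ν : Measure X) := by
          rw [integral_add (integrable_const _) ((hρi ν).const_mul M), integral_const_mul]
          simp
      _ ≤ _ := by gcongr
  filter_upwards [(hρcont.tendsto μ).eventually (gt_mem_nhds hN),
    Metric.continuousAt_iff'.1 hHcont.continuousAt ε hε] with ν h1 h2
  rw [dist_eq_norm] at h2 ⊢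
  have e1 := hest ν h1
  have e2 := hest μ hN
  have e3 : ε * (2 * M + 4) = η := by rw [hεdef]; field_simp
  calc _ = ‖(∫ x, G x ∂(ν : Measure X) - ∫ x, H x ∂(ν : Measure X)) +
        (∫ x, H x ∂(ν : Measure X) - ∫ x, H x ∂(μ : Measure X)) -
        (∫ x, G x ∂(μ : Measure X) - ∫ x, H x ∂(μ : Measure X))‖ := by congr 1; abel
    _ ≤ (ε + M * ε) + ε + (ε + M * ε) :=
        (norm_sub_le _ _).trans (add_le_add ((norm_add_le _ _).trans (add_le_add e1 h2.le)) e2)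
    _ < η := by nlinarith

/-- Dirac measures are exactly those under which every bounded continuous function has variance
zero, and this is a closed condition. -/
theorem isClosedEmbedding_diracProba {X : Type*} [TopologicalSpace X]
    [TopologicalSpace.MetrizableSpace X] [SecondCountableTopology X] [MeasurableSpace X]
    [BorelSpace X] : IsClosedEmbedding (diracProba : X → ProbabilityMeasure X) := by
  refine ⟨isEmbedding_diracProba, ?_⟩
  have e : range (diracProba : X → ProbabilityMeasure X) = ⋂ f : X →ᵇ ℝ,
      {μ : ProbabilityMeasure X |
        ∫ x, (f * f) x ∂(μ : Measure X) = (∫ x, f x ∂(μ : Measure X)) ^ 2} := by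
    ext μ
    simp only [mem_range, mem_iInter, mem_ofPred_eq]
    constructor
    · rintro ⟨x, rfl⟩ f
      simp [diracProba, sq]
    · intro h
      let := TopologicalSpace.metrizableSpaceMetric X
      -- Zero variance makes the truncated distance to a support point `x` almost surely equal to a
      -- constant `c`. If `c` were positive, the neighbourhood `{f < c}` of `x` would be null.
      obtain ⟨x, hx⟩ := (μ : Measure X).nonempty_support (IsProbabilityMeasure.ne_zero _)
      let f : X →ᵇ ℝ := BoundedContinuousFunction.ofNormedAddCommGroup (fun y => min (dist x y) 1)
        (by fun_prop) 1 fun y => by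
          rw [Real.norm_of_nonneg (le_min dist_nonneg zero_le_one)]; exact min_le_right _ _
      set c := ∫ y, f y ∂(μ : Measure X) with hc
      have hfi : Integrable f (μ : Measure X) := f.integrable _
      have hffi : Integrable (f * f) (μ : Measure X) := (f * f).integrable _
      have hz : ∫ y, (f y - c) ^ 2 ∂(μ : Measure X) = 0 := by
        have e1 : ∀ y, (f y - c) ^ 2 = (f * f) y - 2 * c * f y + c ^ 2 := fun y => by
          simp only [BoundedContinuousFunction.coe_mul, Pi.mul_apply]; ring
        simp only [e1]
        have hsub : Integrable (fun y => (f * f) y - 2 * c * f y) (μ : Measure X) :=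
          hffi.sub (hfi.const_mul _)
        rw [integral_add hsub (integrable_const _), integral_sub hffi (hfi.const_mul _), h f,
          integral_const_mul]
        simp only [← hc, integral_const, probReal_univ, smul_eq_mul]
        ring
      have hae : ∀ᵐ y ∂(μ : Measure X), f y = c := by
        have hint : Integrable (fun y => (f y - c) ^ 2) (μ : Measure X) :=
          ((f - BoundedContinuousFunction.const X c) ^ 2).integrable _
        filter_upwards [(integral_eq_zero_iff_of_nonneg (fun y => sq_nonneg _) hint).1 hz]
          with y hy
        exact sub_eq_zero.1 (pow_eq_zero_iff two_ne_zero |>.1 hy)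
      have hc0 : c = 0 := by
        by_contra hne
        have hc_nonneg : 0 ≤ c := integral_nonneg fun y => le_min dist_nonneg zero_le_one
        have hpos : 0 < c := lt_of_le_of_ne hc_nonneg (Ne.symm hne)
        have hU : {y | f y < c} ∈ 𝓝 x := by
          refine (isOpen_lt f.continuous continuous_const).mem_nhds ?_
          simpa [f] using Or.inl hpos
        have h0 : (μ : Measure X) {y | f y < c} = 0 := by
          rw [measure_eq_zero_iff_ae_notMem]
          filter_upwards [hae] with y hy using by simp [hy]
        exact ((Measure.mem_support_iff_forall x).1 hx _ hU).ne' h0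
      refine ⟨x, ?_⟩
      have hxe : ∀ᵐ y ∂(μ : Measure X), y = x := by
        filter_upwards [hae] with y hy
        rw [hc0] at hy
        have hy' : min (dist x y) 1 = 0 := hy
        rcases min_choice (dist x y) 1 with h1 | h1
        · rw [h1] at hy'; exact (dist_eq_zero.1 hy').symm
        · rw [h1] at hy'; exact absurd hy' one_ne_zero
      apply Subtype.ext
      refine Measure.ext fun B hB => ?_
      have e2 : ((diracProba x : ProbabilityMeasure X) : Measure X) B =
          B.indicator 1 x := Measure.dirac_apply' x hB
      change ((diracProba x : ProbabilityMeasure X) : Measure X) B = (μ : Measure X) B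
      rw [e2]
      by_cases hxB : x ∈ B
      · rw [indicator_of_mem hxB, Pi.one_apply]
        refine ((prob_compl_eq_zero_iff hB).1 ?_).symm
        rw [measure_eq_zero_iff_ae_notMem]
        filter_upwards [hxe] with y hy using by simp [hy, hxB]
      · rw [indicator_of_notMem hxB]
        symm
        rw [measure_eq_zero_iff_ae_notMem]
        filter_upwards [hxe] with y hy using by simp [hy, hxB]
  rw [e]
  refine isClosed_iInter fun f => isClosed_eq ?_ ?_
  · exact ProbabilityMeasure.continuous_integral_boundedContinuousFunction (f * f)
  · exact (ProbabilityMeasure.continuous_integral_boundedContinuousFunction f).pow 2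

/-! ### Comparison of initial topologies -/

/-- Restricted to the compact set `C`, the continuous injection `q` is an embedding into a Hausdorff
space, so composing with it does not change the initial topology. -/
theorem induced_comp_eq_of_isCompact {S Y Z : Type*} [TopologicalSpace Y] [TopologicalSpace Z]
    [T2Space Z] {L : S → Y} {q : Y → Z} (hq : Continuous q) (hinj : Function.Injective q)
    {C : Set Y} (hC : IsCompact C) (hL : ∀ s, L s ∈ C) :
    TopologicalSpace.induced (fun s => q (L s)) inferInstance =
      TopologicalSpace.induced L inferInstance := by
  have : CompactSpace C := isCompact_iff_compactSpace.1 hC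
  have hind : IsInducing fun c : C => q c.1 :=
    ((hq.comp continuous_subtype_val).isClosedEmbedding
      (hinj.comp Subtype.val_injective)).isInducing
  let L' : S → C := fun s => ⟨L s, hL s⟩
  have h1 : TopologicalSpace.induced L inferInstance =
      TopologicalSpace.induced L' inferInstance :=
    (induced_compose (f := L') (g := Subtype.val)).symm
  have h2 : TopologicalSpace.induced (fun s => q (L s)) inferInstance =
      TopologicalSpace.induced L' (TopologicalSpace.induced (fun c : C => q c.1) inferInstance) :=
    (induced_compose (f := L') (g := fun c : C => q c.1)).symm
  rw [h1, h2, ← hind.eq_induced]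

theorem semimetricTopology_norm_sub {E F : Type*} [SeminormedAddCommGroup F] (Φ : E → F) :
    semimetricTopology (fun X Y => ‖Φ X - Φ Y‖) = TopologicalSpace.induced Φ inferInstance := by
  refine TopologicalSpace.ext_iff.2 fun s => ?_
  rw [@isOpen_iff_mem_nhds E (TopologicalSpace.induced Φ inferInstance) s]
  refine forall₂_congr fun x _ => ?_
  rw [nhds_induced, Metric.nhds_basis_ball.comap Φ |>.mem_iff]
  refine exists_congr fun ε => and_congr_right fun _ => forall_congr' fun y => ?_
  rw [mem_preimage, Metric.mem_ball, dist_comm, dist_eq_norm]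

/-! ### The Borel spaces of higher rank measures -/

section BorelSp

variable {T : ℕ} {A : BorelSp.{u}}

theorem BorelSp.continuous_eval (t : Fin (T + 1)) :
    Continuous fun x : (A.path T).carrier => (x t : A.carrier) :=
  continuous_apply (A := fun _ : Fin (T + 1) => A.carrier) t

instance BorelSp.polish_path [PolishSpace A.carrier] : PolishSpace (A.path T).carrier :=
  inferInstanceAs (PolishSpace (Fin (T + 1) → A.carrier))

instance BorelSp.polish_prob [PolishSpace A.carrier] : PolishSpace A.prob.carrier :=
  inferInstanceAs (PolishSpace (ProbabilityMeasure A.carrier))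

instance BorelSp.compact_path [CompactSpace A.carrier] : CompactSpace (A.path T).carrier :=
  inferInstanceAs (CompactSpace (Fin (T + 1) → A.carrier))

theorem BorelSp.compact_prob [PolishSpace A.carrier] [CompactSpace A.carrier] :
    CompactSpace A.prob.carrier :=
  inferInstanceAs (CompactSpace (ProbabilityMeasure A.carrier))

instance BorelSp.isProbabilityMeasure_measureOf (μ : A.prob.carrier) :
    IsProbabilityMeasure (BorelSp.measureOf μ) :=
  Subtype.property (p := fun ν : Measure A.carrier => IsProbabilityMeasure ν) μ

theorem BorelSp.measureOf_injective :
    Function.Injective (BorelSp.measureOf : A.prob.carrier → Measure A.carrier) :=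
  ProbabilityMeasure.toMeasure_injective

theorem BorelSp.continuous_integral (φ : A.carrier →ᵇ ℝ) :
    Continuous fun μ : A.prob.carrier => ∫ x, φ x ∂BorelSp.measureOf μ :=
  ProbabilityMeasure.continuous_integral_boundedContinuousFunction φ

instance polish_of {U : Type u} [TopologicalSpace U] [MeasurableSpace U] [BorelSpace U]
    [PolishSpace U] : PolishSpace (BorelSp.of U).carrier :=
  inferInstanceAs (PolishSpace U)

instance polish_probRank [PolishSpace A.carrier] : ∀ k, PolishSpace (probRank T A k).carrier
  | 0 => inferInstanceAs (PolishSpace A.carrier)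
  | k + 1 =>
    have := polish_probRank k
    inferInstanceAs (PolishSpace ((probRank T A k).path T).prob.carrier)

theorem compact_probRank [PolishSpace A.carrier] [CompactSpace A.carrier] :
    ∀ k, CompactSpace (probRank T A k).carrier
  | 0 => inferInstanceAs (CompactSpace A.carrier)
  | k + 1 =>
    have := compact_probRank k
    BorelSp.compact_prob (A := (probRank T A k).path T)

variable [PolishSpace A.carrier] {E : Type*} [MeasurableSpace E]

theorem BorelSp.measurable_path {f : E → (A.path T).carrier}
    (h : ∀ t, Measurable fun e => (f e t : A.carrier)) : Measurable f := by
  have h' : Measurable (fun e t => (f e t : A.carrier) : E → Fin (T + 1) → A.carrier) :=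
    measurable_pi_lambda _ h
  have e : (MeasurableSpace.pi : MeasurableSpace (Fin (T + 1) → A.carrier)) = _root_.borel _ :=
    BorelSpace.measurable_eq
  rw [e] at h'
  exact h'

/-- Reconciles the Borel σ-algebra of the weak topology, carried by `A.prob`, with the σ-algebra of
evaluations used for kernels. -/
theorem BorelSp.measurable_prob_iff {f : E → A.prob.carrier} :
    Measurable f ↔ Measurable fun e => BorelSp.measureOf (f e) := by
  have e := borel_probabilityMeasure (X := A.carrier)
  constructor
  · intro h
    have h' : @Measurable E (ProbabilityMeasure A.carrier) _ (_root_.borel _) f := h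
    rw [← e] at h'
    exact measurable_subtype_coe.comp h'
  · intro h
    have h' : @Measurable E (ProbabilityMeasure A.carrier) _ inferInstance f :=
      Measurable.subtype_mk h
    rw [e] at h'
    exact h'

end BorelSp

/-! ### Existence and basic properties of prediction processes -/

/-- Conditioning on `m` is conditioning on the identity map from `(Ω, mΩ)` to `(Ω, m)`. The
instances are explicit because `Ω` carries two σ-algebras. -/
theorem exists_regular_conditional_distribution {Ω A : Type*} {m mΩ : MeasurableSpace Ω}
    (hm : m ≤ mΩ) (P : Measure Ω) [IsProbabilityMeasure P]
    [MeasurableSpace A] [StandardBorelSpace A] {Z : Ω → A} (hZ : Measurable Z) :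
    ∃ κ : Ω → Measure A, Measurable[m] κ ∧ (∀ ω, IsProbabilityMeasure (κ ω)) ∧
      ∀ B, MeasurableSet B →
        (fun ω => (κ ω).real B) =ᵐ[P] P[(Z ⁻¹' B).indicator fun _ => (1 : ℝ) | m] := by
  have : Nonempty A := P.nonempty_of_neZero.map Z
  let κ : @ProbabilityTheory.Kernel Ω A m _ :=
    @ProbabilityTheory.condDistrib Ω Ω A _ _ _ mΩ m Z id P _
  have hid : @Measurable Ω Ω mΩ m id := fun s hs => hm s hs
  refine ⟨@ProbabilityTheory.Kernel.toFun Ω A m _ κ,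
    @ProbabilityTheory.Kernel.measurable' Ω A m _ κ,
    fun ω => ?_, fun B hB => ?_⟩
  · exact @ProbabilityTheory.IsMarkovKernel.isProbabilityMeasure Ω A m _ κ
      (@ProbabilityTheory.instIsMarkovKernelCondDistrib Ω Ω A _ _ _ mΩ P _ id Z m) ω
  · have h := @ProbabilityTheory.condDistrib_ae_eq_condExp Ω Ω A _ _ _ mΩ P _ id Z m B hid hZ hB
    rw [MeasurableSpace.comap_id] at h
    exact h

section PredictionProcess

variable {T : ℕ} {U : Type u} [MeasurableSpace U]

theorem exists_isPrediction (X : AdaptedProcess.{u, w} T U) {A : BorelSp.{u}}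
    [PolishSpace A.carrier] {Z : X.Ω → A.carrier} (hZ : Measurable Z) :
    ∃ Y, IsPrediction X Z Y := by
  choose κ hκ hprob hcond using fun t =>
    exists_regular_conditional_distribution (X.ℱ.le t) X.P hZ
  let Y : Fin (T + 1) → X.Ω → A.prob.carrier := fun t ω => ⟨κ t ω, hprob t ω⟩
  have hmeas : ∀ t, Measurable[X.ℱ t] (Y t) := fun t =>
    (@BorelSp.measurable_prob_iff A _ X.Ω (X.ℱ t) (Y t)).2 (hκ t)
  exact ⟨fun ω t => Y t ω,
    BorelSp.measurable_path fun t => (hmeas t).mono (X.ℱ.le t) le_rfl, hmeas, hcond⟩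

/-- Integrals against the conditional distribution are conditional expectations. -/
theorem IsPrediction.condExp_ae_eq {X : AdaptedProcess.{u, w} T U} {A : BorelSp.{u}}
    [PolishSpace A.carrier] {Z : X.Ω → A.carrier} {Y : X.Ω → (A.prob.path T).carrier}
    (h : IsPrediction X Z Y) (hZ : Measurable Z) (φ : A.carrier →ᵇ ℝ) (t : Fin (T + 1)) :
    MeasureTheory.condExp (X.ℱ t) X.P (fun ω => φ (Z ω)) =ᵐ[X.P]
      fun ω => ∫ x, φ x ∂BorelSp.measureOf (Y ω t) := by
  have hm := X.ℱ.le t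
  have hYm : Measurable[X.ℱ t] fun ω => ∫ x, φ x ∂BorelSp.measureOf (Y ω t) :=
    (BorelSp.continuous_integral φ).measurable.comp (h.adapted t)
  have hYΩ : Measurable fun ω => (Y ω t : A.prob.carrier) := (h.adapted t).mono hm le_rfl
  have hκm : Measurable fun ω => BorelSp.measureOf (Y ω t) := BorelSp.measurable_prob_iff.1 hYΩ
  have hbound : ∀ ω, ‖∫ x, φ x ∂BorelSp.measureOf (Y ω t)‖ ≤ ‖φ‖ := fun ω => by
    have := norm_integral_le_of_norm_le_const (μ := BorelSp.measureOf (Y ω t))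
      (ae_of_all _ fun x => φ.norm_coe_le_norm x)
    simpa using this
  have hYi : Integrable (fun ω => ∫ x, φ x ∂BorelSp.measureOf (Y ω t)) X.P :=
    Integrable.of_bound (hYm.mono hm le_rfl).aestronglyMeasurable _ (ae_of_all _ hbound)
  have hφi : Integrable (fun ω => φ (Z ω)) X.P :=
    Integrable.of_bound (φ.continuous.measurable.comp hZ).aestronglyMeasurable ‖φ‖
      (ae_of_all _ fun ω => φ.norm_coe_le_norm _)
  refine (ae_eq_condExp_of_forall_setIntegral_eq hm hφi (fun s _ _ => hYi.integrableOn) ?_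
    hYm.stronglyMeasurable.aestronglyMeasurable).symm
  intro s hs _
  let κ : ProbabilityTheory.Kernel X.Ω A.carrier := ⟨fun ω => BorelSp.measureOf (Y ω t), hκm⟩
  -- The defining property for sets `B`, integrated over `s ∈ ℱ_t`, is an equality of measures;
  -- integrating `φ` against both sides gives the claim.
  have hbind : (X.P.restrict s).bind κ = (X.P.restrict s).map Z := by
    refine Measure.ext fun B hB => ?_
    rw [Measure.bind_apply hB κ.measurable.aemeasurable, Measure.map_apply hZ hB]
    have hreal : ∀ ω, κ ω B = ENNReal.ofReal ((BorelSp.measureOf (Y ω t)).real B) := fun ω => by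
      simp only [κ, ProbabilityTheory.Kernel.coe_mk]
      rw [measureReal_def, ENNReal.ofReal_toReal (measure_ne_top _ _)]
    have hint : Integrable (fun ω => (BorelSp.measureOf (Y ω t)).real B) X.P :=
      Integrable.of_bound (((Measure.measurable_coe hB).comp hκm).ennreal_toReal
        ).aestronglyMeasurable 1 (ae_of_all _ fun ω => by
          rw [Real.norm_of_nonneg measureReal_nonneg]; exact measureReal_le_one)
    simp only [hreal]
    rw [← ofReal_integral_eq_lintegral_ofReal hint.integrableOn
      (ae_of_all _ fun ω => measureReal_nonneg),
      setIntegral_congr_ae (hm s hs) ((h.condLaw t B hB).mono fun ω hω _ => hω),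
      setIntegral_condExp hm ((integrable_const _).indicator (hZ hB)) hs,
      integral_indicator_const _ (hZ hB)]
    simp
  have e1 : ∫ ω in s, φ (Z ω) ∂X.P = ∫ x, φ x ∂((X.P.restrict s).map Z) :=
    (integral_map hZ.aemeasurable φ.continuous.aestronglyMeasurable).symm
  have hci : Integrable φ ((X.P.restrict s).bind κ) := hbind ▸ φ.integrable _
  have e2 : ∫ x, φ x ∂((X.P.restrict s).bind κ) =
      ∫ ω in s, ∫ x, φ x ∂BorelSp.measureOf (Y ω t) ∂X.P := by
      rw [Measure.comp_eq_comp_const_apply] at hci ⊢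
      rw [ProbabilityTheory.Kernel.integral_comp hci]
      rfl
  rw [e1, ← hbind, e2]

theorem isPrediction_predict (X : AdaptedProcess.{u, w} T U) {A : BorelSp.{u}}
    [PolishSpace A.carrier] (Z : {Z : X.Ω → A.carrier // Measurable Z}) :
    IsPrediction X Z.1 (predict X Z).1 := by
  have h := exists_isPrediction X Z.2
  rw [predict, dif_pos h]
  exact h.choose_spec

variable [TopologicalSpace U] [BorelSpace U] [PolishSpace U]

theorem AdaptedProcess.isPrediction_prediction (X : AdaptedProcess.{u, w} T U) (k : ℕ) :
    IsPrediction X (X.prediction k).1 (X.prediction (k + 1)).1 :=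
  isPrediction_predict X (X.prediction k)

theorem AdaptedProcess.prediction_adapted (X : AdaptedProcess.{u, w} T U) (t : Fin (T + 1)) :
    ∀ k, Measurable[X.ℱ t] fun ω => ((X.prediction k).1 ω t : (probRank T (BorelSp.of U) k).carrier)
  | 0 => X.adapted t
  | k + 1 => (X.isPrediction_prediction k).adapted t

/-- The complement of `z` is a union of countably many basis sets that miss `z`. Countability
permits a single exceptional null set in the application below. -/
theorem dirac_of_forall_basis {E : Type*} [TopologicalSpace E] [T1Space E] [MeasurableSpace E]
    [BorelSpace E] [SecondCountableTopology E] {ν : Measure E} [IsProbabilityMeasure ν] {z : E}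
    (h : ∀ b ∈ TopologicalSpace.countableBasis E, z ∉ b → ν b = 0) : ν = Measure.dirac z := by
  have h0 : ν {z}ᶜ = 0 := by
    obtain ⟨S, hS, hU⟩ := (TopologicalSpace.isBasis_countableBasis E).open_eq_sUnion
      (isOpen_compl_singleton (x := z))
    rw [hU]
    refine (measure_sUnion_null_iff ((TopologicalSpace.countable_countableBasis E).mono hS)).2
      fun b hb => h b (hS hb) fun hz => ?_
    have : z ∈ ({z} : Set E)ᶜ := hU ▸ mem_sUnion_of_mem hz hb
    exact this rfl
  have hae : ∀ᵐ y ∂ν, y = z := by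
    rw [ae_iff]
    exact h0
  refine Measure.ext fun B hB => ?_
  rw [Measure.dirac_apply' z hB]
  by_cases hz : z ∈ B
  · rw [indicator_of_mem hz, Pi.one_apply]
    refine (prob_compl_eq_zero_iff hB).1 ?_
    rw [measure_eq_zero_iff_ae_notMem]
    filter_upwards [hae] with y hy using by simp [hy, hz]
  · rw [indicator_of_notMem hz, measure_eq_zero_iff_ae_notMem]
    filter_upwards [hae] with y hy using by simp [hy, hz]

/-- The time `t` marginal of `P(X̂^k ∈ · | ℱ_t)` is the Dirac measure at `X̂^k_t`. -/
theorem AdaptedProcess.map_eval_prediction (X : AdaptedProcess.{u, w} T U) (k : ℕ)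
    (t : Fin (T + 1)) : ∀ᵐ ω ∂X.P,
      (BorelSp.measureOf (X := (probRank T (BorelSp.of U) k).path T)
        ((X.prediction (k + 1)).1 ω t)).map (fun x => (x t : (probRank T (BorelSp.of U) k).carrier))
        = Measure.dirac ((X.prediction k).1 ω t : (probRank T (BorelSp.of U) k).carrier) := by
  have hev : Measurable fun x : ((probRank T (BorelSp.of U) k).path T).carrier =>
      (x t : (probRank T (BorelSp.of U) k).carrier) := (BorelSp.continuous_eval t).measurable
  have hb : ∀ b ∈ TopologicalSpace.countableBasis (probRank T (BorelSp.of U) k).carrier,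
      ∀ᵐ ω ∂X.P, ((X.prediction k).1 ω t : (probRank T (BorelSp.of U) k).carrier) ∉ b →
        (BorelSp.measureOf (X := (probRank T (BorelSp.of U) k).path T)
          ((X.prediction (k + 1)).1 ω t)).real ((fun x => x t) ⁻¹' b) = 0 := by
    intro b hb
    have hbm : MeasurableSet b :=
      (TopologicalSpace.isOpen_of_mem_countableBasis hb).measurableSet
    have h1 := (X.isPrediction_prediction k).condLaw t _ (hev hbm)
    -- The event `X̂^k_t ∈ b` belongs to `ℱ_t`, so its conditional probability is its indicator.
    have h2 : StronglyMeasurable[X.ℱ t]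
        (((X.prediction k).1 ⁻¹' ((fun x => x t) ⁻¹' b)).indicator fun _ => (1 : ℝ)) :=
      stronglyMeasurable_const.indicator (X.prediction_adapted t k hbm)
    rw [condExp_of_stronglyMeasurable (X.ℱ.le t) h2 ((integrable_const _).indicator
      ((X.prediction k).2 (hev hbm)))] at h1
    filter_upwards [h1] with ω hω hnot
    have hnot' : ω ∉ (X.prediction k).1 ⁻¹' ((fun x => x t) ⁻¹' b) := hnot
    exact hω.trans (indicator_of_notMem hnot' fun _ => (1 : ℝ))
  have hall := (ae_ball_iff
    (TopologicalSpace.countable_countableBasis (probRank T (BorelSp.of U) k).carrier)).2 hb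
  filter_upwards [hall] with ω hω
  have hp : IsProbabilityMeasure (BorelSp.measureOf
      (X := (probRank T (BorelSp.of U) k).path T) ((X.prediction (k + 1)).1 ω t)) :=
    BorelSp.isProbabilityMeasure_measureOf (A := (probRank T (BorelSp.of U) k).path T) _
  have := Measure.isProbabilityMeasure_map (μ := BorelSp.measureOf
    (X := (probRank T (BorelSp.of U) k).path T) ((X.prediction (k + 1)).1 ω t)) hev.aemeasurable
  refine dirac_of_forall_basis fun b hb hz => ?_
  rw [Measure.map_apply hev (TopologicalSpace.isOpen_of_mem_countableBasis hb).measurableSet]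
  exact (measureReal_eq_zero_iff (measure_ne_top _ _)).1 (hω b hb hz)

/-! ### Adapted functionals as continuous functions of the prediction process -/

/-- The adapted functional `f` is the function `φ` of the rank `k` prediction process. -/
def Represents (k : ℕ) (f : AdaptedFunctional T U)
    (φ : ((probRank T (BorelSp.of U) k).path T).carrier →ᵇ ℝ) : Prop :=
  ∀ X : AdaptedProcess.{u, w} T U, f.eval X =ᵐ[X.P] fun ω => φ ((X.prediction k).1 ω)

/-- Bounded continuous functions of the rank `k` prediction process are bounded continuous
functions of the rank `k + 1` prediction process. -/
theorem exists_prediction_lift (k : ℕ)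
    (φ : ((probRank T (BorelSp.of U) k).path T).carrier →ᵇ ℝ) :
    ∃ ψ : ((probRank T (BorelSp.of U) (k + 1)).path T).carrier →ᵇ ℝ,
      ∀ X : AdaptedProcess.{u, w} T U, ∀ᵐ ω ∂X.P,
        ψ ((X.prediction (k + 1)).1 ω) = φ ((X.prediction k).1 ω) := by
  let A := probRank T (BorelSp.of U) k
  -- The value `X̂^k_t` is encoded in `X̂^{k+1}_t` as a Dirac marginal. Tuples of Dirac measures
  -- form a closed copy of the path space, from which Tietze's theorem extends `φ` to all tuples of
  -- measures.
  let e : (A.path T).carrier → Fin (T + 1) → ProbabilityMeasure A.carrier :=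
    fun z t => diracProba (z t : A.carrier)
  have he : IsClosedEmbedding e :=
    IsClosedEmbedding.piMap (ι := Fin (T + 1)) (A := fun _ => A.carrier)
      fun _ => isClosedEmbedding_diracProba
  obtain ⟨ψ₀, -, hψ₀⟩ :=
    BoundedContinuousFunction.exists_extension_norm_eq_of_isClosedEmbedding φ he
  have hev : ∀ t, Continuous fun x : (A.path T).carrier => (x t : A.carrier) :=
    BorelSp.continuous_eval
  let marg : (((A.path T).prob).path T).carrier → Fin (T + 1) → ProbabilityMeasure A.carrier :=
    fun m t => ProbabilityMeasure.map (Ω := (A.path T).carrier) (m t)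
      (f := fun x => (x t : A.carrier)) (hev t).measurable.aemeasurable
  have hmarg : Continuous marg := continuous_pi fun t =>
    (ProbabilityMeasure.continuous_map (hev t)).comp
      (BorelSp.continuous_eval (A := (A.path T).prob) t)
  refine ⟨ψ₀.compContinuous ⟨marg, hmarg⟩, fun X => ?_⟩
  filter_upwards [ae_all_iff.2 fun t => X.map_eval_prediction k t] with ω hω
  have h1 : marg ((X.prediction (k + 1)).1 ω) = e ((X.prediction k).1 ω) :=
    funext fun t => Subtype.ext (hω t)
  have h2 : φ ((X.prediction k).1 ω) = ψ₀ (e ((X.prediction k).1 ω)) := by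
    rw [← hψ₀]; rfl
  rw [h2, ← h1]
  rfl

theorem exists_represents_of_le {k l : ℕ} (hkl : k ≤ l) {f : AdaptedFunctional T U}
    {φ : ((probRank T (BorelSp.of U) k).path T).carrier →ᵇ ℝ} (h : Represents.{u, w} k f φ) :
    ∃ ψ, Represents.{u, w} l f ψ := by
  induction l, hkl using Nat.le_induction with
  | base => exact ⟨φ, h⟩
  | succ l _ ih =>
    obtain ⟨ψ, hψ⟩ := ih
    obtain ⟨χ, hχ⟩ := exists_prediction_lift.{u, w} l ψ
    refine ⟨χ, fun X => ?_⟩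
    filter_upwards [hψ X, hχ X] with ω h1 h2
    rw [h1, h2]

theorem Represents.comp {k n : ℕ} {f : Fin n → AdaptedFunctional T U}
    {φ : Fin n → ((probRank T (BorelSp.of U) k).path T).carrier →ᵇ ℝ}
    (h : ∀ i, Represents.{u, w} k (f i) (φ i)) (g : (Fin n → ℝ) →ᵇ ℝ) :
    Represents.{u, w} k (.comp g f)
      (g.compContinuous ⟨fun x i => φ i x, continuous_pi fun i => (φ i).continuous⟩) := by
  intro X
  filter_upwards [ae_all_iff.2 fun i => h i X] with ω hω
  simp only [AdaptedFunctional.eval, hω]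
  rfl

/-- Integration of `φ` against the value at time `t`. -/
def integralAt {A : BorelSp.{u}} (t : Fin (T + 1)) (φ : A.carrier →ᵇ ℝ) :
    (A.prob.path T).carrier →ᵇ ℝ :=
  BoundedContinuousFunction.ofNormedAddCommGroup
    (fun m => ∫ x, φ x ∂BorelSp.measureOf (m t))
    ((BorelSp.continuous_integral φ).comp (BorelSp.continuous_eval t)) ‖φ‖ fun m => by
      have := norm_integral_le_of_norm_le_const (μ := BorelSp.measureOf (m t))
        (ae_of_all _ fun x => φ.norm_coe_le_norm x)
      simpa using this

theorem Represents.condExp {k : ℕ} {f : AdaptedFunctional T U}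
    {φ : ((probRank T (BorelSp.of U) k).path T).carrier →ᵇ ℝ} (h : Represents.{u, w} k f φ)
    (t : Fin (T + 1)) :
    Represents.{u, w} (k + 1) (.condExp t f)
      (integralAt (A := (probRank T (BorelSp.of U) k).path T) t φ) := by
  intro X
  exact (condExp_congr_ae (h X)).trans
    ((X.isPrediction_prediction k).condExp_ae_eq (X.prediction k).2 φ t)

/-- The statement covers every `k` above the rank, so that the arguments of a composition can share
one `k`. Marginals start at rank `0` and are lifted. -/
theorem exists_represents (f : AdaptedFunctional T U) :
    ∀ k, f.rank ≤ k → ∃ φ, Represents.{u, w} k f φ := by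
  induction f with
  | @marginal n t f =>
    intro k _
    have h0 : Represents.{u, w} 0 (.marginal t f) (f.compContinuous
        ⟨fun (x : ((BorelSp.of U).path T).carrier) i => (x (t i) : U),
          continuous_pi fun i => BorelSp.continuous_eval (A := BorelSp.of U) (t i)⟩) :=
      fun X => Eventually.of_forall fun ω => rfl
    exact exists_represents_of_le (Nat.zero_le k) h0
  | comp g f ih =>
    intro k hk
    choose φ hφ using fun i => ih i k ((Finset.le_sup (Finset.mem_univ i)).trans hk)
    exact ⟨_, Represents.comp hφ g⟩
  | condExp t f ih =>
    intro k hk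
    obtain ⟨k, rfl⟩ : ∃ l, k = l + 1 := ⟨k - 1, by simp [AdaptedFunctional.rank] at hk; omega⟩
    obtain ⟨φ, hφ⟩ := ih k (Nat.le_of_succ_le_succ hk)
    exact ⟨_, hφ.condExp t⟩

theorem Represents.expect_eq {k : ℕ} {f : AdaptedFunctional T U}
    {φ : ((probRank T (BorelSp.of U) k).path T).carrier →ᵇ ℝ} (h : Represents.{u, w} k f φ)
    (X : AdaptedProcess.{u, w} T U) :
    f.expect X = ∫ x, φ x ∂BorelSp.measureOf
      (X := (probRank T (BorelSp.of U) k).path T) (X.lawPrediction k) := by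
  rw [AdaptedFunctional.expect, integral_congr_ae (h X)]
  exact (integral_map (X.prediction k).2.aemeasurable φ.continuous.aestronglyMeasurable).symm

/-! ### Adapted functionals determine the law of the prediction process -/

/-- The functions of the rank `k` prediction process that are adapted functionals of rank at most
`k`. -/
def representables (k : ℕ) : Set (((probRank T (BorelSp.of U) k).path T).carrier →ᵇ ℝ) :=
  {φ | ∃ f ∈ AF T U k, Represents.{u, w} k f φ}

theorem representables_map₂ {k : ℕ}
    {φ ψ χ : ((probRank T (BorelSp.of U) k).path T).carrier →ᵇ ℝ}
    (hφ : φ ∈ representables.{u, w} k) (hψ : ψ ∈ representables.{u, w} k) {G : ℝ → ℝ → ℝ}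
    (hG : Continuous fun p : ℝ × ℝ => G p.1 p.2) (hχ : ∀ x, χ x = G (φ x) (ψ x)) :
    χ ∈ representables.{u, w} k := by
  obtain ⟨f, hf, hfφ⟩ := hφ
  obtain ⟨f', hf', hfψ⟩ := hψ
  let M := max ‖φ‖ ‖ψ‖
  let c : ℝ → ℝ := fun x => max (-M) (min M x)
  have hM : 0 ≤ M := (norm_nonneg φ).trans (le_max_left _ _)
  have hc : Continuous c := by fun_prop
  have hcmem : ∀ x, c x ∈ Icc (-M) M := fun x =>
    ⟨le_max_left _ _, max_le (by linarith) (min_le_left _ _)⟩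
  have hcid : ∀ x : ℝ, |x| ≤ M → c x = x := fun x hx => by
    have := abs_le.1 hx
    simp only [c]
    rw [min_eq_right this.2, max_eq_right this.1]
  obtain ⟨B, hB⟩ := (isCompact_Icc.prod isCompact_Icc).exists_bound_of_continuousOn
    (s := Icc (-M) M ×ˢ Icc (-M) M) hG.continuousOn
  let g : (Fin 2 → ℝ) →ᵇ ℝ := BoundedContinuousFunction.ofNormedAddCommGroup
    (fun v => G (c (v 0)) (c (v 1)))
    (hG.comp ((hc.comp (continuous_apply 0)).prodMk (hc.comp (continuous_apply 1)))) B
    fun v => hB (c (v 0), c (v 1)) ⟨hcmem _, hcmem _⟩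
  refine ⟨.comp g ![f, f'], ?_, ?_⟩
  · change (Finset.univ.sup fun i => (![f, f'] i).rank) ≤ k
    refine Finset.sup_le fun i _ => ?_
    fin_cases i
    · exact hf
    · exact hf'
  · have h := Represents.comp (f := ![f, f']) (φ := ![φ, ψ]) (k := k)
      (fun i => by fin_cases i; exacts [hfφ, hfψ]) g
    convert h using 1
    ext x
    have e1 : c (φ x) = φ x := hcid _ ((φ.norm_coe_le_norm x).trans (le_max_left _ _))
    have e2 : c (ψ x) = ψ x := hcid _ ((ψ.norm_coe_le_norm x).trans (le_max_right _ _))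
    rw [hχ x]
    change _ = G (c (φ x)) (c (ψ x))
    rw [e1, e2]

theorem const_mem_representables (k : ℕ) (a : ℝ) :
    BoundedContinuousFunction.const _ a ∈ representables.{u, w} (T := T) (U := U) k :=
  ⟨.marginal (n := 0) Fin.elim0 (BoundedContinuousFunction.const _ a), Nat.zero_le _,
    fun _ => Eventually.of_forall fun _ => rfl⟩

/-- The algebra of the functions of the rank `k` prediction process that are adapted functionals
of rank at most `k`. -/
def representableAlgebra (T : ℕ) (U : Type u) [MeasurableSpace U] [TopologicalSpace U]
    [BorelSpace U] [PolishSpace U] (k : ℕ) :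
    StarSubalgebra ℝ (((probRank T (BorelSp.of U) k).path T).carrier →ᵇ ℝ) where
  carrier := representables.{u, w} k
  mul_mem' h h' := representables_map₂ h h' (G := fun x y => x * y) (by fun_prop) fun _ => rfl
  add_mem' h h' := representables_map₂ h h' (G := fun x y => x + y) (by fun_prop) fun _ => rfl
  algebraMap_mem' a := const_mem_representables k a
  star_mem' {φ} h := by
    have : star φ = φ := by ext x; simp
    rwa [this]

/-- A Stone–Weierstrass argument: on a Polish space measures are tight, so a point-separating
algebra of bounded continuous functions determines them without being uniformly dense. -/
theorem eq_of_forall_integral_eq {A : BorelSp.{u}} [PolishSpace A.carrier]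
    {S : StarSubalgebra ℝ (A.carrier →ᵇ ℝ)} (hS : ∀ x y, x ≠ y → ∃ φ ∈ S, φ x ≠ φ y)
    {μ ν : A.prob.carrier}
    (h : ∀ φ ∈ S, ∫ x, φ x ∂BorelSp.measureOf μ = ∫ x, φ x ∂BorelSp.measureOf ν) : μ = ν := by
  refine BorelSp.measureOf_injective
    (ext_of_forall_mem_subalgebra_integral_eq_of_polish (𝕜 := ℝ) (A := S) ?_ h)
  intro x y hxy
  obtain ⟨φ, hφ, hne⟩ := hS x y hxy
  exact ⟨φ, ⟨φ.toContinuousMap, ⟨φ, hφ, rfl⟩, rfl⟩, hne⟩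

theorem exists_boundedContinuous_ne {E : Type*} [TopologicalSpace E]
    [TopologicalSpace.MetrizableSpace E] {x y : E} (h : x ≠ y) : ∃ φ : E →ᵇ ℝ, φ x ≠ φ y := by
  let := TopologicalSpace.metrizableSpaceMetric E
  let φ : E →ᵇ ℝ := BoundedContinuousFunction.ofNormedAddCommGroup
    (fun z => min (dist z x) 1) (by fun_prop) 1 fun z => by
      rw [Real.norm_of_nonneg (le_min dist_nonneg zero_le_one)]; exact min_le_right _ _
  have h1 : φ x = 0 := by simp [φ]
  have h2 : 0 < φ y := lt_min (dist_pos.2 h.symm) one_pos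
  exact ⟨φ, h1.trans_ne h2.ne⟩

/-- For the step, points of rank `k + 1` that differ at time `t` are distinct measures there. The
algebra of rank `k` separates points, hence these measures, and its integrals at time `t` represent
the conditional expectations given `ℱ_t`. -/
theorem representableAlgebra_separates (k : ℕ) :
    ∀ x y : ((probRank T (BorelSp.of U) k).path T).carrier, x ≠ y →
      ∃ φ ∈ representableAlgebra.{u, w} T U k, φ x ≠ φ y := by
  induction k with
  | zero =>
    intro x y hxy
    obtain ⟨φ, hφ⟩ := exists_boundedContinuous_ne (E := Fin (T + 1) → U) hxy
    exact ⟨φ, ⟨.marginal (n := T + 1) id φ, Nat.zero_le _,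
      fun X => Eventually.of_forall fun ω => rfl⟩, hφ⟩
  | succ k ih =>
    intro x y hxy
    obtain ⟨t, ht⟩ := Function.ne_iff.1 hxy
    by_contra! hcon
    refine ht (eq_of_forall_integral_eq (A := (probRank T (BorelSp.of U) k).path T) ih
      fun φ hφ => ?_)
    obtain ⟨f, hf, hfφ⟩ := hφ
    exact hcon (integralAt (A := (probRank T (BorelSp.of U) k).path T) t φ)
      ⟨.condExp t f, Nat.succ_le_succ hf, hfφ.condExp t⟩

/-- The integrals of the functions that represent adapted functionals of rank at most `r`. -/
def representableIntegrals (T : ℕ) (U : Type u) [MeasurableSpace U]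
    [TopologicalSpace U] [BorelSpace U] [PolishSpace U] (r : ℕ)
    (μ : (probRank T (BorelSp.of U) (r + 1)).carrier)
    (φ : representables.{u, w} (T := T) (U := U) r) : ℝ :=
  ∫ x, φ.1 x ∂BorelSp.measureOf (X := (probRank T (BorelSp.of U) r).path T) μ

theorem continuous_representableIntegrals (r : ℕ) :
    Continuous (representableIntegrals.{u, w} T U r) :=
  continuous_pi fun φ => BorelSp.continuous_integral
    (A := (probRank T (BorelSp.of U) r).path T) φ.1

theorem injective_representableIntegrals (r : ℕ) :
    Function.Injective (representableIntegrals.{u, w} T U r) := fun _ _ h =>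
  eq_of_forall_integral_eq (A := (probRank T (BorelSp.of U) r).path T)
    (representableAlgebra_separates.{u, w} r) fun φ hφ => congrFun h ⟨φ, hφ⟩

theorem forall_expect_eq_iff (r : ℕ) (X Y : AdaptedProcess.{u, w} T U) :
    (∀ f ∈ AF T U r, f.expect X = f.expect Y) ↔ X.lawPrediction r = Y.lawPrediction r := by
  constructor
  · refine fun h => injective_representableIntegrals.{u, w} r (funext fun φ => ?_)
    obtain ⟨f, hf, hφ⟩ := φ.2
    exact ((hφ.expect_eq X).symm.trans (h f hf)).trans (hφ.expect_eq Y)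
  · intro h f hf
    obtain ⟨φ, hφ⟩ := exists_represents.{u, w} f r hf
    rw [hφ.expect_eq, hφ.expect_eq, h]

/-- Every functional in `AF_r` has its expectation among the coordinates of
`representableIntegrals`, and every coordinate is the expectation of such a functional. -/
theorem tau_eq_induced (r : ℕ) :
    tau.{u, w} T U r = TopologicalSpace.induced
      (fun X => representableIntegrals.{u, w} T U r (X.lawPrediction r)) inferInstance := by
  refine le_antisymm ?_ ?_
  · rw [← continuous_iff_le_induced]
    refine @continuous_pi _ _ _ (tau.{u, w} T U r) _ _ fun φ => ?_
    obtain ⟨f, hf, hφ⟩ := φ.2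
    rw [continuous_iff_le_induced]
    refine (iInf₂_le f hf).trans (le_of_eq ?_)
    congr 1
    exact funext fun X => hφ.expect_eq X
  · refine le_iInf₂ fun f hf => ?_
    rw [← continuous_iff_le_induced]
    obtain ⟨φ, hφ⟩ := exists_represents.{u, w} f r hf
    let q := fun X : AdaptedProcess.{u, w} T U =>
      representableIntegrals.{u, w} T U r (X.lawPrediction r)
    let : TopologicalSpace (AdaptedProcess.{u, w} T U) := TopologicalSpace.induced q inferInstance
    have hq : Continuous q := continuous_induced_dom
    have h := (continuous_apply (A := fun _ => ℝ)
      (⟨φ, f, hf, hφ⟩ : representables.{u, w} (T := T) (U := U) r)).comp hq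
    convert h using 1
    exact funext fun X => hφ.expect_eq X

end PredictionProcess

/-! ### Shuffles and deconcatenation of words -/

section Words

variable {E : Type*}

/-- The list of shuffles of two words. -/
def shuffles : List E → List E → List (List E)
  | [], v => [v]
  | a :: u, [] => [a :: u]
  | a :: u, b :: v => (shuffles u (b :: v)).map (a :: ·) ++ (shuffles (a :: u) v).map (b :: ·)
termination_by u v => u.length + v.length

/-- The sum of `f` over the shuffles of two words. -/
def shuffleSum (f : List E → ℝ) (u v : List E) : ℝ := ((shuffles u v).map f).sum

@[simp] theorem shuffleSum_nil_left (f : List E → ℝ) (v : List E) : shuffleSum f [] v = f v := by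
  simp [shuffleSum, shuffles]

@[simp] theorem shuffleSum_nil_right (f : List E → ℝ) (u : List E) : shuffleSum f u [] = f u := by
  cases u <;> simp [shuffleSum, shuffles]

theorem shuffleSum_cons_cons (f : List E → ℝ) (a b : E) (u v : List E) :
    shuffleSum f (a :: u) (b :: v) =
      shuffleSum (fun w => f (a :: w)) u (b :: v) +
        shuffleSum (fun w => f (b :: w)) (a :: u) v := by
  simp [shuffleSum, shuffles, Function.comp_def]

theorem shuffleSum_mul_add (c : ℝ) (f g : List E → ℝ) (u v : List E) :
    shuffleSum (fun w => c * f w + g w) u v = c * shuffleSum f u v + shuffleSum g u v := by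
  simp [shuffleSum, List.sum_map_add, List.sum_map_mul_left]

/-- The sum of `G` over the deconcatenations of a word. -/
def splitSum : (List E → List E → ℝ) → List E → ℝ
  | G, [] => G [] []
  | G, a :: u => G [] (a :: u) + splitSum (fun p q => G (a :: p) q) u

theorem splitSum_add (G H : List E → List E → ℝ) (u : List E) :
    splitSum (fun p q => G p q + H p q) u = splitSum G u + splitSum H u := by
  induction u generalizing G H with
  | nil => rfl
  | cons a u ih => simp only [splitSum, ih]; ring

theorem splitSum_mul_left (c : ℝ) (G : List E → List E → ℝ) (u : List E) :
    splitSum (fun p q => c * G p q) u = c * splitSum G u := by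
  induction u generalizing G with
  | nil => rfl
  | cons a u ih => simp only [splitSum, ih]; ring

theorem splitSum_eq_sum (G : List E → List E → ℝ) (u : List E) :
    splitSum G u = ∑ i ∈ Finset.range (u.length + 1), G (u.take i) (u.drop i) := by
  induction u generalizing G with
  | nil => simp [splitSum]
  | cons a u ih => 
    rw [splitSum, ih, List.length_cons, Finset.sum_range_succ' _ (u.length + 1)]
    simp [add_comm]

/-- The convolution product of functions of words. -/
def wordConv (f h : List E → ℝ) (u : List E) : ℝ := splitSum (fun p q => f p * h q) u

theorem wordConv_cons (f h : List E → ℝ) (a : E) (u : List E) :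
    wordConv f h (a :: u) = f [] * h (a :: u) + wordConv (fun w => f (a :: w)) h u := rfl

/-- Deconcatenation is a homomorphism for the shuffle product. -/
theorem shuffleSum_wordConv (f h : List E → ℝ) (u v : List E) :
    shuffleSum (wordConv f h) u v = splitSum (fun p q => splitSum
      (fun p' q' => shuffleSum f p p' * shuffleSum h q q') v) u := by
  induction u, v using shuffles.induct generalizing f with
  | case1 v => simp [splitSum, wordConv]
  | case2 a u => simp [splitSum, wordConv]
  | case3 a u b v ih1 ih2 =>
    rw [shuffleSum_cons_cons]
    simp only [wordConv_cons, shuffleSum_mul_add, ih1, ih2]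
    simp only [splitSum, shuffleSum_nil_left, shuffleSum_nil_right, shuffleSum_cons_cons, add_mul,
      splitSum_add]
    ring

/-- Characters of the shuffle algebra. -/
structure IsGroupLike (f : List E → ℝ) : Prop where
  nil : f [] = 1
  mul : ∀ u v, f u * f v = shuffleSum f u v

theorem IsGroupLike.wordConv {f h : List E → ℝ} (hf : IsGroupLike f) (hh : IsGroupLike h) :
    IsGroupLike (wordConv f h) where
  nil := by simp [AdaptedSig.wordConv, splitSum, hf.nil, hh.nil]
  mul u v := by
    rw [shuffleSum_wordConv]
    simp only [← hf.mul, ← hh.mul]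
    have : ∀ p q : List E, splitSum (fun p' q' => f p * f p' * (h q * h q')) v =
        AdaptedSig.wordConv f h v * (f p * h q) := fun p q => by
      rw [mul_comm, AdaptedSig.wordConv, ← splitSum_mul_left]
      congr 1
      funext p' q'
      ring
    simp only [this]
    rw [splitSum_mul_left, mul_comm]
    rfl

/-- All shuffles of `u` and `v` have the same length. -/
theorem shuffleSum_length_mul (c : ℕ → ℝ) (f : List E → ℝ) (u v : List E) :
    shuffleSum (fun w => c w.length * f w) u v = c (u.length + v.length) * shuffleSum f u v := by
  induction u, v using shuffles.induct generalizing c f with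
  | case1 v => simp
  | case2 a u => simp
  | case3 a u b v ih1 ih2 =>
    have h1 := ih1 (fun n => c (n + 1)) (fun w => f (a :: w))
    have h2 := ih2 (fun n => c (n + 1)) (fun w => f (b :: w))
    rw [shuffleSum_cons_cons, shuffleSum_cons_cons]
    simp only [List.length_cons] at h1 h2 ⊢
    rw [h1, h2, mul_add]
    congr 3
    ring

theorem IsGroupLike.scale {f : List E → ℝ} (hf : IsGroupLike f) (c : ℝ) :
    IsGroupLike fun w => c ^ w.length * f w where
  nil := by simp [hf.nil]
  mul u v := by
    rw [shuffleSum_length_mul (fun n => c ^ n), ← hf.mul, pow_add]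
    ring

/-- The product ignores the order of letters, so every shuffle contributes equally. The induction
that counts them is Pascal's rule. -/
theorem shuffleSum_prod (φ : E → ℝ) (u v : List E) :
    shuffleSum (fun w => (w.map φ).prod) u v =
      ((u.length + v.length).choose u.length : ℝ) * ((u.map φ).prod * (v.map φ).prod) := by
  induction u, v using shuffles.induct with
  | case1 v => simp
  | case2 a u => simp
  | case3 a u b v ih1 ih2 =>
    have e : ∀ (c : ℝ) (u v : List E), shuffleSum (fun w => c * (w.map φ).prod) u v =
        c * shuffleSum (fun w => (w.map φ).prod) u v := fun c u v =>
      shuffleSum_length_mul (fun _ => c) _ u v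
    rw [shuffleSum_cons_cons]
    simp only [List.map_cons, List.prod_cons, e, ih1, ih2, List.length_cons]
    have h1 : u.length + 1 + (v.length + 1) = (u.length + v.length + 1) + 1 := by ring
    have h2 : u.length + (v.length + 1) = u.length + v.length + 1 := by ring
    have h3 : u.length + 1 + v.length = u.length + v.length + 1 := by ring
    rw [h1, h2, h3, Nat.choose_succ_succ (u.length + v.length + 1) u.length]
    push_cast
    ring

theorem isGroupLike_exp (φ : E → ℝ) :
    IsGroupLike fun w : List E => (w.length.factorial : ℝ)⁻¹ * (w.map φ).prod where
  nil := by simp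
  mul u v := by
    rw [shuffleSum_length_mul (fun n => (n.factorial : ℝ)⁻¹), shuffleSum_prod]
    have h := Nat.add_choose_mul_factorial_mul_factorial u.length v.length
    rw [← Nat.choose_symm_add] at h
    have h' : ((u.length + v.length).choose u.length : ℝ) * u.length.factorial
        * v.length.factorial = (u.length + v.length).factorial := by exact_mod_cast h
    have := Nat.factorial_ne_zero u.length
    have := Nat.factorial_ne_zero v.length
    rw [← h']
    have : ((u.length + v.length).choose u.length : ℝ) ≠ 0 :=
      Nat.cast_ne_zero.2 (Nat.choose_pos (Nat.le_add_right _ _)).ne'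
    field_simp

/-- A cut of `e ⋯ e l` falls either before the last letter, splitting the block of `e`, or after it.
-/
theorem splitSum_replicate_append (G : List E → List E → ℝ) (e l : E) (a : ℕ) :
    splitSum G (List.replicate a e ++ [l]) = ∑ p ∈ Finset.HasAntidiagonal.antidiagonal a,
      G (List.replicate p.1 e) (List.replicate p.2 e ++ [l]) +
        G (List.replicate a e ++ [l]) [] := by
  induction a generalizing G with
  | zero => simp [splitSum]
  | succ a ih =>
    rw [List.replicate_succ, List.cons_append, splitSum, ih, Finset.Nat.sum_antidiagonal_succ,
      ← add_assoc]
    rfl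

end Words

/-! ### Evaluation of tensor series on words of functionals -/

section TensorWords

variable {W : Type u} [NormedAddCommGroup W] [NormedSpace ℝ W]

/-- The linear form `ℓ₁ ⊗ ⋯ ⊗ ℓₙ`. -/
def tensorForm {n : ℕ} (ℓ : Fin n → (W →L[ℝ] ℝ)) : ⨂[ℝ]^n W →ₗ[ℝ] ℝ :=
  PiTensorProduct.lift ((MultilinearMap.mkPiAlgebra ℝ (Fin n) ℝ).compLinearMap
    fun i => (ℓ i : W →ₗ[ℝ] ℝ))

theorem tensorForm_tprod {n : ℕ} (ℓ : Fin n → (W →L[ℝ] ℝ)) (v : Fin n → W) :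
    tensorForm ℓ (PiTensorProduct.tprod ℝ v) = ∏ i, ℓ i (v i) := by
  simp [tensorForm]

/-- Multiplication of tensors as a bilinear map. -/
def tpMulₗ (W : Type u) [NormedAddCommGroup W] [NormedSpace ℝ W] (m n : ℕ) :
    ⨂[ℝ]^m W →ₗ[ℝ] ⨂[ℝ]^n W →ₗ[ℝ] ⨂[ℝ]^(m + n) W :=
  (TensorProduct.mk ℝ (⨂[ℝ]^m W) (⨂[ℝ]^n W)).compr₂ TensorPower.mulEquiv.toLinearMap

theorem tpMulₗ_apply {m n : ℕ} (s : ⨂[ℝ]^m W) (t : ⨂[ℝ]^n W) : tpMulₗ W m n s t = tpMul s t := rfl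

theorem tpMul_tprod {m n : ℕ} (a : Fin m → W) (b : Fin n → W) :
    tpMul (PiTensorProduct.tprod ℝ a) (PiTensorProduct.tprod ℝ b) =
      PiTensorProduct.tprod ℝ (Fin.append a b) :=
  TensorPower.tprod_mul_tprod ℝ a b

theorem tensorForm_tpMul {m n : ℕ} (ℓ : Fin (m + n) → (W →L[ℝ] ℝ)) (s : ⨂[ℝ]^m W)
    (t : ⨂[ℝ]^n W) : tensorForm ℓ (tpMul s t) =
      tensorForm (fun i => ℓ (Fin.castAdd n i)) s * tensorForm (fun i => ℓ (Fin.natAdd m i)) t := by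
  have h : (tpMulₗ W m n).compr₂ (tensorForm ℓ) =
      (LinearMap.mul ℝ ℝ).compl₁₂ (tensorForm fun i => ℓ (Fin.castAdd n i))
        (tensorForm fun i => ℓ (Fin.natAdd m i)) := by
    ext a b
    simp only [LinearMap.compMultilinearMap_apply, LinearMap.compr₂_apply, LinearMap.compl₁₂_apply,
      tpMulₗ_apply, tpMul_tprod, tensorForm_tprod, LinearMap.mul_apply', Fin.prod_univ_add,
      Fin.append_left, Fin.append_right]
  exact LinearMap.congr_fun₂ h s t

theorem tensorForm_cast {m n : ℕ} (h : m = n) (ℓ : Fin n → (W →L[ℝ] ℝ)) (t : ⨂[ℝ]^m W) :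
    tensorForm ℓ (TensorPower.cast ℝ W h t) = tensorForm (fun i => ℓ (Fin.cast h i)) t := by
  subst h
  rw [TensorPower.cast_refl]
  rfl

/-- The value of a tensor series on a word of functionals. -/
def wordEval (s : TSeries W) (w : List (W →L[ℝ] ℝ)) : ℝ := tensorForm w.get (s w.length)

theorem tensorForm_congr (s : TSeries W) {m n : ℕ} (h : m = n) (ℓ : Fin m → (W →L[ℝ] ℝ))
    (ℓ' : Fin n → (W →L[ℝ] ℝ)) (hℓ : ∀ i, ℓ i = ℓ' (Fin.cast h i)) :
    tensorForm ℓ (s m) = tensorForm ℓ' (s n) := by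
  subst h
  congr 2
  exact funext hℓ

theorem wordEval_tmul (s t : TSeries W) :
    wordEval (tmul s t) = wordConv (wordEval s) (wordEval t) := by
  funext w
  rw [wordConv, splitSum_eq_sum, wordEval, tmul, map_sum, Finset.sum_range]
  refine Finset.sum_congr rfl fun i _ => ?_
  have hi : (i : ℕ) ≤ w.length := Nat.le_of_lt_succ i.2
  rw [tensorForm_cast, tensorForm_tpMul]
  congr 1
  · refine tensorForm_congr s (by simp [hi]) _ _ fun j => ?_
    simp
  · refine tensorForm_congr t (by simp) _ _ fun j => ?_
    simp

theorem wordEval_texp (v : W) : wordEval (texp v) =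
    fun w => (w.length.factorial : ℝ)⁻¹ * (w.map fun ℓ => ℓ v).prod := by
  funext w
  rw [wordEval, texp, map_smul, tensorForm_tprod, smul_eq_mul]
  congr 1
  rw [← List.prod_ofFn]
  congr 1
  conv_rhs => rw [← List.ofFn_get w, List.map_ofFn]
  rfl

/-- Lets the empty product in the inductions below be treated as an exponential. -/
theorem tone_eq_texp_zero : (tone : TSeries W) = texp 0 := by
  funext m
  cases m with
  | zero =>
    rw [tone, Pi.single_eq_same, texp, Nat.factorial_zero, Nat.cast_one, inv_one, one_smul]
    change PiTensorProduct.tprod ℝ _ = _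
    congr 1
    exact funext fun i => i.elim0
  | succ m =>
    rw [tone, Pi.single_eq_of_ne (Nat.succ_ne_zero m), texp]
    rw [MultilinearMap.map_coord_zero _ (0 : Fin (m + 1)) rfl, smul_zero]

theorem isGroupLike_wordEval_texp (v : W) : IsGroupLike (wordEval (texp v)) := by
  rw [wordEval_texp]
  exact isGroupLike_exp fun ℓ : W →L[ℝ] ℝ => ℓ v

theorem isGroupLike_wordEval_foldr {n : ℕ} (v : Fin n → W) :
    IsGroupLike (wordEval ((List.ofFn fun t => texp (v t)).foldr tmul tone)) := by
  induction n with
  | zero =>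
    rw [List.ofFn_zero, List.foldr_nil, tone_eq_texp_zero]
    exact isGroupLike_wordEval_texp 0
  | succ n ih =>
    rw [List.ofFn_succ, List.foldr_cons, wordEval_tmul]
    exact (isGroupLike_wordEval_texp _).wordConv (ih fun i => v i.succ)

theorem isGroupLike_sigSeries {T : ℕ} (x : Fin (T + 1) → W) :
    IsGroupLike (wordEval (sigSeries x)) := isGroupLike_wordEval_foldr (incr x)

/-! ### Injectivity of the signature -/

open PowerSeries in
/-- Values on the words `e ⋯ e ℓ` of a product of exponentials of vectors `v` with `e v = 1`. -/
theorem wordEval_foldr_replicate {n : ℕ} (v : Fin n → W) (e ℓ : W →L[ℝ] ℝ) (he : ∀ i, e (v i) = 1) :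
    (PowerSeries.mk fun a => wordEval ((List.ofFn fun t => texp (v t)).foldr tmul tone)
      (List.replicate a e ++ [ℓ])) =
      (∑ i : Fin n, PowerSeries.C (ℓ (v i)) * PowerSeries.exp ℝ ^ (i : ℕ)) *
        PowerSeries.mk fun a => (((a + 1).factorial : ℝ)⁻¹) := by
  induction n with
  | zero =>
    ext a
    rw [List.ofFn_zero, List.foldr_nil, tone_eq_texp_zero, wordEval_texp]
    simp
  | succ n ih =>
    -- With `E = ∑ x^a / (a + 1)!`, splitting off the first exponential gives the recursion `P_{n+1}
    -- = ℓ(v 0) E + exp · P_n`: either `ℓ` is read in the first factor, or that factor reads only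
    -- letters `e`.
    have ih' := ih (fun i => v i.succ) fun i => he i.succ
    rw [Fin.sum_univ_succ]
    simp only [Fin.val_zero, pow_zero, mul_one, Fin.val_succ, pow_succ']
    have h1 : ∑ i : Fin n, PowerSeries.C (ℓ (v i.succ)) * (exp ℝ * exp ℝ ^ (i : ℕ)) =
        exp ℝ * ∑ i : Fin n, PowerSeries.C (ℓ (v i.succ)) * exp ℝ ^ (i : ℕ) := by
      rw [Finset.mul_sum]
      exact Finset.sum_congr rfl fun i _ => by ring
    rw [h1, add_mul, mul_assoc, ← ih']
    ext a
    have hnil := (isGroupLike_wordEval_foldr fun i => v i.succ).nil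
    rw [map_add, coeff_mk, List.ofFn_succ, List.foldr_cons, wordEval_tmul, wordConv,
      splitSum_replicate_append, hnil, coeff_C_mul, coeff_mk, coeff_mul, add_comm]
    congr 1
    · simp [wordEval_texp, he, mul_comm]
    · refine Finset.sum_congr rfl fun p _ => ?_
      simp [wordEval_texp, he, coeff_exp]

/-- The coefficient of order `a` is `∑ c_i i^a / a!`. The nodes `0, …, n - 1` are distinct, so the
Vandermonde system has only one solution. -/
theorem eq_of_sum_exp_pow_eq {n : ℕ} {c d : Fin n → ℝ}
    (h : ∑ i : Fin n, PowerSeries.C (c i) * PowerSeries.exp ℝ ^ (i : ℕ) =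
      ∑ i : Fin n, PowerSeries.C (d i) * PowerSeries.exp ℝ ^ (i : ℕ)) : c = d := by
  have hinj : Function.Injective fun i : Fin n => ((i : ℕ) : ℝ) :=
    Nat.cast_injective.comp Fin.val_injective
  refine sub_eq_zero.1 (Matrix.eq_zero_of_forall_pow_sum_mul_pow_eq_zero hinj fun a => ?_)
  have ha := congrArg (PowerSeries.coeff (a : ℕ)) h
  have hf : ((a : ℕ).factorial : ℝ) ≠ 0 := Nat.cast_ne_zero.2 (Nat.factorial_ne_zero _)
  simp only [map_sum, PowerSeries.coeff_C_mul, PowerSeries.exp_pow_eq_rescale_exp,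
    PowerSeries.coeff_rescale, PowerSeries.coeff_exp] at ha
  simp only [← mul_assoc, ← Finset.sum_mul] at ha
  have h2 : algebraMap ℚ ℝ (1 / ((a : ℕ).factorial : ℚ)) ≠ 0 := by
    simpa using hf
  have h3 := mul_right_cancel₀ h2 ha
  simp only [Pi.sub_apply, sub_mul, Finset.sum_sub_distrib, h3, sub_self]

/-- The time coordinate `e` equals `1` on all increments, so words `e ⋯ e ℓ` reveal `ℓ` of each
increment separately. By Hahn–Banach these values determine the increments, and since the first of
them is `x 0`, also the path. -/
theorem path_eq_of_wordEval_eq {T : ℕ} {x y : Fin (T + 1) → W}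
    (h : wordEval (sigSeries x) = wordEval (sigSeries y)) : x = y := by
  let e : Aug W →L[ℝ] ℝ := WithLp.fstL 1 ℝ ℝ W
  -- The common factor has constant term `1` and can be cancelled.
  have hE : (PowerSeries.mk fun a => (((a + 1).factorial : ℝ)⁻¹)) ≠ 0 := fun h0 => by
    have := congrArg (PowerSeries.coeff 0) h0
    simp at this
  have hd : ∀ t, (incr x t).snd = (incr y t).snd := fun t => by
    refine (SeparatingDual.eq_iff_forall_dual_eq (R := ℝ)).2 fun ℓ => ?_
    let ℓ' : Aug W →L[ℝ] ℝ := ℓ.comp (WithLp.sndL 1 ℝ ℝ W)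
    have hx := wordEval_foldr_replicate (incr x) e ℓ' fun _ => rfl
    have hy := wordEval_foldr_replicate (incr y) e ℓ' fun _ => rfl
    have hxy : (List.ofFn fun t => texp (incr x t)).foldr tmul tone = sigSeries x := rfl
    have hyy : (List.ofFn fun t => texp (incr y t)).foldr tmul tone = sigSeries y := rfl
    rw [hxy, h] at hx
    rw [hyy] at hy
    exact congrFun (eq_of_sum_exp_pow_eq (mul_right_cancel₀ hE (hx.symm.trans hy))) t
  funext t
  induction t using Fin.induction with
  | zero => exact hd 0
  | succ t ih =>
    have h1 : x t.succ - x t.castSucc = y t.succ - y t.castSucc := hd t.succ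
    rw [ih] at h1
    exact sub_left_inj.1 h1

end TensorWords

/-! ### Continuity of the signature -/

section Continuity

variable {W : Type u} [NormedAddCommGroup W] [NormedSpace ℝ W]

/-- The identity from the algebraic to the normed tensor power. -/
def TPow.of (α : AdmissibleNorm W) (m : ℕ) : ⨂[ℝ]^m W ≃ₗ[ℝ] TPow α m :=
  LinearEquiv.refl ℝ (⨂[ℝ]^m W)

theorem TPow.norm_of (α : AdmissibleNorm W) {m : ℕ} (t : ⨂[ℝ]^m W) :
    ‖TPow.of α m t‖ = α.nrm m t := rfl

/-- The functional `ℓ₁ ⊗ ⋯ ⊗ ℓₙ` on the normed tensor power. -/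
def formCLM (α : AdmissibleNorm W) {n : ℕ} (ℓ : Fin n → (W →L[ℝ] ℝ)) : TPow α n →L[ℝ] ℝ :=
  LinearMap.mkContinuous ((tensorForm ℓ).comp (TPow.of α n).symm.toLinearMap) (∏ i, ‖ℓ i‖)
    fun t => α.dual_le n ℓ t

/-- The functional on the completed tensor algebra given by a word of functionals. -/
def wordCLM (α : AdmissibleNorm W) (w : List (W →L[ℝ] ℝ)) : TAlg α →L[ℝ] ℝ :=
  ((formCLM α w.get).extend (UniformSpace.Completion.toComplL (𝕜 := ℝ))).comp
    (lp.evalCLM ℝ (fun m : ℕ => UniformSpace.Completion (TPow α m)) 1 w.length)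

theorem wordCLM_of_eq (α : AdmissibleNorm W) (w : List (W →L[ℝ] ℝ)) {t : TAlg α} {s : TSeries W}
    {c : ℝ} (h : t w.length = c • TPow.toCompletion α w.length (s w.length)) :
    wordCLM α w t = c * wordEval s w := by
  change (formCLM α w.get).extend (UniformSpace.Completion.toComplL (𝕜 := ℝ)) (t w.length) = _
  rw [h, map_smul, smul_eq_mul]
  congr 1
  exact ContinuousLinearMap.extend_eq (formCLM α w.get)
    (e := UniformSpace.Completion.toComplL (𝕜 := ℝ))
    UniformSpace.Completion.denseRange_coe
    (UniformSpace.Completion.isUniformInducing_coe _) (s w.length)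

theorem continuous_texp (α : AdmissibleNorm W) {X : Type*} [TopologicalSpace X] {v : X → W}
    (hv : Continuous v) (m : ℕ) : Continuous fun x => TPow.of α m (texp (v x) m) := by
  have h : Continuous ((TPow.of α m).toLinearMap.compMultilinearMap
      (PiTensorProduct.tprod ℝ (s := fun _ : Fin m => W))) :=
    MultilinearMap.continuous_of_bound _ 1 fun v => by
      rw [one_mul]; exact α.tprod_le m v
  exact (h.comp (continuous_pi fun _ : Fin m => hv)).const_smul ((m.factorial : ℝ)⁻¹)

/-- Multiplication of tensors as a bilinear map of normed tensor powers. -/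
def TPow.mulₗ (α : AdmissibleNorm W) {i j m : ℕ} (h : i + j = m) :
    TPow α i →ₗ[ℝ] TPow α j →ₗ[ℝ] TPow α m :=
  ((tpMulₗ W i j).compr₂
    ((TPow.of α m).toLinearMap.comp (TensorPower.cast ℝ W h).toLinearMap)).compl₁₂
    (TPow.of α i).symm.toLinearMap (TPow.of α j).symm.toLinearMap

theorem TPow.mulₗ_of (α : AdmissibleNorm W) {i j m : ℕ} (h : i + j = m) (s : ⨂[ℝ]^i W)
    (t : ⨂[ℝ]^j W) : TPow.mulₗ α h (TPow.of α i s) (TPow.of α j t) =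
      TPow.of α m (TensorPower.cast ℝ W h (tpMul s t)) := rfl

theorem TPow.norm_mulₗ_le (α : AdmissibleNorm W) {i j m : ℕ} (h : i + j = m) (a : TPow α i)
    (b : TPow α j) : ‖TPow.mulₗ α h a b‖ ≤ 1 * ‖a‖ * ‖b‖ := by
  obtain ⟨s, rfl⟩ := (TPow.of α i).surjective a
  obtain ⟨t, rfl⟩ := (TPow.of α j).surjective b
  rw [TPow.mulₗ_of, TPow.norm_of, TPow.norm_of, TPow.norm_of, α.nrm_cast, one_mul]
  exact α.mul_le _ _ s t

theorem continuous_bilinear_of_bound {E F G : Type*} [SeminormedAddCommGroup E] [NormedSpace ℝ E]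
    [SeminormedAddCommGroup F] [NormedSpace ℝ F] [SeminormedAddCommGroup G] [NormedSpace ℝ G]
    (B : E →ₗ[ℝ] F →ₗ[ℝ] G) {C : ℝ} (hB : ∀ a b, ‖B a b‖ ≤ C * ‖a‖ * ‖b‖) {X : Type*}
    [TopologicalSpace X] {a : X → E} {b : X → F} (ha : Continuous a) (hb : Continuous b) :
    Continuous fun x => B (a x) (b x) :=
  (LinearMap.mkContinuous₂ B C hB).continuous₂.comp (ha.prodMk hb)

theorem TPow.continuous_mulₗ (α : AdmissibleNorm W) {i j m : ℕ} (h : i + j = m) {X : Type*}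
    [TopologicalSpace X] {a : X → TPow α i} {b : X → TPow α j} (ha : Continuous a)
    (hb : Continuous b) : Continuous fun x => TPow.mulₗ α h (a x) (b x) :=
  continuous_bilinear_of_bound (TPow.mulₗ α h) (TPow.norm_mulₗ_le α h) ha hb

theorem continuous_tmul (α : AdmissibleNorm W) {X : Type*} [TopologicalSpace X]
    {s t : X → TSeries W} (hs : ∀ m, Continuous fun x => TPow.of α m (s x m))
    (ht : ∀ m, Continuous fun x => TPow.of α m (t x m)) (m : ℕ) :
    Continuous fun x => TPow.of α m (tmul (s x) (t x) m) := by
  simp only [tmul, map_sum]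
  simp only [← TPow.mulₗ_of]
  exact continuous_finsetSum _ fun i _ =>
    TPow.continuous_mulₗ α (Nat.add_sub_of_le (Nat.le_of_lt_succ i.2)) (hs i) (ht (m - i))

theorem continuous_foldr_texp (α : AdmissibleNorm W) {X : Type*} [TopologicalSpace X] {n : ℕ}
    {v : X → Fin n → W} (hv : ∀ i, Continuous fun x => v x i) (m : ℕ) :
    Continuous fun x =>
      TPow.of α m ((List.ofFn fun t => texp (v x t)).foldr tmul tone m) := by
  induction n generalizing m with
  | zero =>
    simp only [List.ofFn_zero, List.foldr_nil]
    exact continuous_const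
  | succ n ih =>
    simp only [List.ofFn_succ, List.foldr_cons]
    exact continuous_tmul α (continuous_texp α (hv 0)) (ih fun i => hv i.succ) m

theorem nrm_texp_le (α : AdmissibleNorm W) (v : W) (m : ℕ) :
    α.nrm m (texp v m) ≤ ‖v‖ ^ m / m.factorial := by
  rw [texp, map_smul_eq_mul, Real.norm_of_nonneg (by positivity), div_eq_inv_mul]
  refine mul_le_mul_of_nonneg_left ((α.tprod_le m _).trans ?_) (by positivity)
  simp

/-- Exponential bounds multiply by the binomial theorem, so signatures are dominated by the
exponential series of the total length of the increments. -/
theorem nrm_tmul_le (α : AdmissibleNorm W) {s t : TSeries W} {a b : ℝ} (ha : 0 ≤ a)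
    (hs : ∀ m, α.nrm m (s m) ≤ a ^ m / m.factorial)
    (ht : ∀ m, α.nrm m (t m) ≤ b ^ m / m.factorial) (m : ℕ) :
    α.nrm m (tmul s t m) ≤ (a + b) ^ m / m.factorial := by
  refine (Finset.le_sum_of_subadditive (α.nrm m) (map_zero _).le (map_add_le_add _) _ _).trans ?_
  rw [add_pow, Finset.sum_div, Finset.sum_range]
  refine Finset.sum_le_sum fun i _ => ?_
  have hi : (i : ℕ) ≤ m := Nat.le_of_lt_succ i.2
  rw [α.nrm_cast]
  refine (α.mul_le _ _ _ _).trans ((mul_le_mul (hs i) (ht (m - i)) (apply_nonneg _ _)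
    (by positivity)).trans (le_of_eq ?_))
  have hch : ((m.choose i : ℕ) : ℝ) = m.factorial / ((i : ℕ).factorial * (m - i).factorial) :=
    Nat.cast_choose ℝ hi
  have h0 : (m.factorial : ℝ) ≠ 0 := Nat.cast_ne_zero.2 (Nat.factorial_ne_zero _)
  rw [hch]
  field_simp

theorem nrm_foldr_texp_le (α : AdmissibleNorm W) {n : ℕ} (v : Fin n → W) (m : ℕ) :
    α.nrm m ((List.ofFn fun t => texp (v t)).foldr tmul tone m) ≤
      (∑ i, ‖v i‖) ^ m / m.factorial := by
  induction n generalizing m with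
  | zero =>
    rw [List.ofFn_zero, List.foldr_nil, tone_eq_texp_zero]
    simpa using nrm_texp_le α (0 : W) m
  | succ n ih =>
    rw [List.ofFn_succ, List.foldr_cons, Fin.sum_univ_succ]
    exact nrm_tmul_le α (norm_nonneg _) (nrm_texp_le α (v 0)) (ih fun i => v i.succ) m

/-- A map into `ℓ¹` with continuous coordinates and locally uniform summable bounds is
continuous. -/
theorem continuous_lp_one_of_dominated {X : Type*} [TopologicalSpace X] {G : ℕ → Type*}
    [∀ m, NormedAddCommGroup (G m)] {f : X → lp G 1} (hf : ∀ m, Continuous fun x => f x m)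
    (hb : ∀ x₀, ∃ b : ℕ → ℝ, Summable b ∧ ∀ᶠ x in 𝓝 x₀, ∀ m, ‖f x m‖ ≤ b m) :
    Continuous f := by
  refine continuous_iff_continuousAt.2 fun x₀ => ?_
  obtain ⟨b, hbs, hbx⟩ := hb x₀
  rw [ContinuousAt, tendsto_iff_norm_sub_tendsto_zero]
  have hn : ∀ x, ‖f x - f x₀‖ = ∑' m, ‖f x m - f x₀ m‖ := fun x => by
    rw [lp.norm_eq_tsum_rpow (by simp)]
    simp
  have hlim := tendsto_tsum_of_dominated_convergence (𝓕 := 𝓝 x₀)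
    (f := fun x m => ‖f x m - f x₀ m‖) (g := fun _ => (0 : ℝ)) (bound := fun m => b m + b m)
    (hbs.add hbs)
    (fun m => by
      have := ((hf m).sub (continuous_const (y := f x₀ m))).norm.tendsto x₀
      simpa using this)
    (by
      filter_upwards [hbx] with x hx m
      rw [norm_norm]
      exact (norm_sub_le _ _).trans (add_le_add (hx m) (hbx.self_of_nhds m)))
  simpa only [hn, tsum_zero] using hlim

theorem continuous_incr {E : Type u} [NormedAddCommGroup E] {T : ℕ} (t : Fin (T + 1)) :
    Continuous fun x : Fin (T + 1) → E => incr x t := by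
  refine (WithLp.prod_continuous_toLp 1 ℝ E).comp (continuous_const.prodMk ?_)
  induction t using Fin.cases with
  | zero => exact continuous_apply 0
  | succ s => exact (continuous_apply s.succ).sub (continuous_apply s.castSucc)

theorem continuous_signature {T : ℕ} (α : AdmissibleNorm (Aug W)) :
    Continuous (signature (T := T) (W := W) α) := by
  refine continuous_lp_one_of_dominated (fun m => ?_) fun x₀ => ?_
  · exact (UniformSpace.Completion.continuous_coe (TPow α m)).comp
      (continuous_foldr_texp α continuous_incr m)
  · have hc : Continuous fun x : Fin (T + 1) → W => ∑ t, ‖incr x t‖ :=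
      continuous_finsetSum _ fun t _ => (continuous_incr t).norm
    refine ⟨fun m => (∑ t, ‖incr x₀ t‖ + 1) ^ m / m.factorial,
      Real.summable_pow_div_factorial _, ?_⟩
    filter_upwards [(hc.tendsto x₀).eventually (gt_mem_nhds (lt_add_one _))] with x hx m
    have h1 : ‖signature α x m‖ = α.nrm m (sigSeries x m) := TPow.norm_toCompletion α m _
    rw [h1]
    refine (nrm_foldr_texp_le α (incr x) m).trans ?_
    have h2 : 0 ≤ ∑ t, ‖incr x t‖ := Finset.sum_nonneg fun t _ => norm_nonneg _
    gcongr

theorem foldr_texp_zero {n : ℕ} (v : Fin n → W) :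
    (List.ofFn fun t => texp (v t)).foldr tmul tone 0 = tpOne W := by
  have h1 : ∀ a : Fin 0 → W, PiTensorProduct.tprod ℝ a = tpOne W := fun a => by
    change _ = PiTensorProduct.tprod ℝ _
    congr 1
    exact funext fun i => i.elim0
  induction n with
  | zero =>
    rw [List.ofFn_zero, List.foldr_nil, tone, Pi.single_eq_same]
  | succ n ih =>
    have h2 : texp (v 0) 0 = PiTensorProduct.tprod ℝ (Fin.elim0 : Fin 0 → W) := by
      rw [h1, texp, h1]
      simp
    rw [List.ofFn_succ, List.foldr_cons, tmul, Fin.sum_univ_one]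
    simp only [Fin.val_zero, Nat.sub_zero]
    rw [ih fun i => v i.succ, h2, ← h1 Fin.elim0, tpMul_tprod, TensorPower.cast_tprod, h1, h1]

theorem signature_mem_unital {T : ℕ} (α : AdmissibleNorm (Aug W)) (x : Fin (T + 1) → W) :
    signature α x ∈ unital α :=
  congrArg (TPow.toCompletion α 0) (foldr_texp_zero (incr x))

end Continuity

/-! ### Characteristic path features -/

/-- Continuous path features with values in the group-like elements whose coordinates separate
paths. -/
structure IsCharacteristic {α : TensorNorms.{u}} {T : ℕ} (F : PathFeature α T) : Prop where
  continuous : ∀ (W : Type u) [NormedAddCommGroup W] [NormedSpace ℝ W], Continuous (F W)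
  groupLike : ∀ (W : Type u) [NormedAddCommGroup W] [NormedSpace ℝ W] (x : Fin (T + 1) → W),
    IsGroupLike fun w => wordCLM (α (Aug W)) w (F W x)
  separates : ∀ (W : Type u) [NormedAddCommGroup W] [NormedSpace ℝ W] (x y : Fin (T + 1) → W),
    (∀ w, wordCLM (α (Aug W)) w (F W x) = wordCLM (α (Aug W)) w (F W y)) → x = y

theorem wordCLM_signature {W : Type u} [NormedAddCommGroup W] [NormedSpace ℝ W] {T : ℕ}
    (α : AdmissibleNorm (Aug W)) (x : Fin (T + 1) → W) (w : List (Aug W →L[ℝ] ℝ)) :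
    wordCLM α w (signature α x) = wordEval (sigSeries x) w := by
  rw [wordCLM_of_eq α w (c := 1) (s := sigSeries x) (one_smul ℝ _).symm, one_mul]

theorem wordCLM_normalization {W : Type u} [NormedAddCommGroup W] [NormedSpace ℝ W] {T : ℕ}
    {α : AdmissibleNorm (Aug W)} (Λ : TensorNormalization α) (x : Fin (T + 1) → W)
    (w : List (Aug W →L[ℝ] ℝ)) : wordCLM α w (Λ.toFun (signature α x)) =
      Λ.lam (signature α x) ^ w.length * wordEval (sigSeries x) w :=
  wordCLM_of_eq α w (Λ.apply_eq _ (signature_mem_unital α x) w.length)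

/-- The elapsed time is the same for all paths. This fixed nonzero coordinate exposes the scaling
factor of a normalization. -/
theorem wordEval_foldr_singleton {W : Type u} [NormedAddCommGroup W] [NormedSpace ℝ W] {n : ℕ}
    (v : Fin n → W) (e : W →L[ℝ] ℝ) (he : ∀ i, e (v i) = 1) :
    wordEval ((List.ofFn fun t => texp (v t)).foldr tmul tone) [e] = n := by
  induction n with
  | zero =>
    rw [List.ofFn_zero, List.foldr_nil, tone_eq_texp_zero, wordEval_texp]
    simp
  | succ n ih =>
    rw [List.ofFn_succ, List.foldr_cons, wordEval_tmul]
    simp only [wordConv, splitSum]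
    rw [ih (fun i => v i.succ) fun i => he i.succ, (isGroupLike_wordEval_texp _).nil,
      (isGroupLike_wordEval_foldr fun i => v i.succ).nil, wordEval_texp]
    simp [he]

theorem isCharacteristic_classicalSig (α : TensorNorms.{u}) (T : ℕ) :
    IsCharacteristic (classicalSig α T) where
  continuous W _ _ := continuous_signature (α (Aug W))
  groupLike W _ _ x := by
    simp only [classicalSig, wordCLM_signature]
    exact isGroupLike_sigSeries x
  separates W _ _ x y h := by
    simp only [classicalSig, wordCLM_signature] at h
    exact path_eq_of_wordEval_eq (funext h)

theorem isCharacteristic_robustSig (α : TensorNorms.{u}) (Λ : TensorNormalizations α) (T : ℕ) :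
    IsCharacteristic (robustSig α Λ T) where
  continuous W _ _ := (Λ (Aug W)).continuousOn.comp_continuous (continuous_signature (α (Aug W)))
    (signature_mem_unital (α (Aug W)))
  groupLike W _ _ x := by
    simp only [robustSig, wordCLM_normalization]
    exact (isGroupLike_sigSeries x).scale _
  separates W _ _ x y h := by
    simp only [robustSig, wordCLM_normalization] at h
    have hT : ((T + 1 : ℕ) : ℝ) ≠ 0 := Nat.cast_ne_zero.2 T.succ_ne_zero
    have hsing : ∀ z : Fin (T + 1) → W,
        wordEval (sigSeries z) [WithLp.fstL 1 ℝ ℝ W] = ((T + 1 : ℕ) : ℝ) :=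
      fun z => wordEval_foldr_singleton (incr z) _ fun _ => rfl
    -- On this word the robust signature takes the value `λ · (T + 1)`. Hence both paths have the
    -- same `λ > 0`, which divides out of all other coordinates.
    have hlam := h [WithLp.fstL 1 ℝ ℝ W]
    rw [hsing, hsing, List.length_singleton, pow_one, pow_one] at hlam
    have hlam' := mul_right_cancel₀ hT hlam
    refine path_eq_of_wordEval_eq (funext fun w => ?_)
    have hw := h w
    rw [hlam'] at hw
    exact mul_left_cancel₀
      (pow_pos ((Λ (Aug W)).lam_pos _ (signature_mem_unital (α (Aug W)) y)) _).ne' hw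

/-! ### Expected features determine measures -/

/-- The expectation of a bounded continuous group-like feature with separating coordinates
determines the measure. -/
theorem injective_integral_of_isGroupLike {A : BorelSp.{u}} [PolishSpace A.carrier] {W : Type u}
    [NormedAddCommGroup W] [NormedSpace ℝ W] {α : AdmissibleNorm W} {G : A.carrier → TAlg α}
    (hG : Continuous G) {C : ℝ} (hC : ∀ x, ‖G x‖ ≤ C)
    (hgl : ∀ x, IsGroupLike fun w => wordCLM α w (G x))
    (hsep : ∀ x y, (∀ w, wordCLM α w (G x) = wordCLM α w (G y)) → x = y) :
    Function.Injective fun μ : A.prob.carrier => ∫ x, G x ∂BorelSp.measureOf μ := by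
  intro μ ν hμν
  let φ : List (W →L[ℝ] ℝ) → (A.carrier →ᵇ ℝ) := fun w =>
    BoundedContinuousFunction.ofNormedAddCommGroup (fun x => wordCLM α w (G x))
      ((wordCLM α w).continuous.comp hG) (‖wordCLM α w‖ * C)
      fun x => (wordCLM α w).le_opNorm_of_le (hC x)
  -- The span of the coordinates is already an algebra: the empty word is the unit, and a product of
  -- two coordinates is the sum over their shuffles. Linear functionals commute with the Bochner
  -- integral, so the expected feature fixes all integrals over this span.
  let p : Submodule ℝ (A.carrier →ᵇ ℝ) := Submodule.span ℝ (range φ)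
  have hone : (1 : A.carrier →ᵇ ℝ) ∈ p := by
    have : φ [] = 1 := by ext x; exact (hgl x).nil
    exact this ▸ Submodule.subset_span ⟨[], rfl⟩
  have hφ : ∀ u v, φ u * φ v = ((shuffles u v).map φ).sum := fun u v => by
    ext x
    have e : (((shuffles u v).map φ).sum : A.carrier →ᵇ ℝ) x =
        ((shuffles u v).map fun w => wordCLM α w (G x)).sum := by
      generalize shuffles u v = L
      induction L with
      | nil => rfl
      | cons a L ih =>
        simp only [List.map_cons, List.sum_cons, BoundedContinuousFunction.coe_add, Pi.add_apply,
          ih]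
        rfl
    rw [e]
    exact (hgl x).mul u v
  have hmul : ∀ f g, f ∈ p → g ∈ p → f * g ∈ p := fun f g hf hg => by
    have h1 : f * g ∈ p * p := Submodule.mul_mem_mul hf hg
    rw [Submodule.span_mul_span] at h1
    refine Submodule.span_le.2 ?_ h1
    rintro _ ⟨_, ⟨u, rfl⟩, _, ⟨v, rfl⟩, rfl⟩
    change φ u * φ v ∈ p
    rw [hφ]
    refine list_sum_mem fun f hf => ?_
    obtain ⟨w, -, rfl⟩ := List.mem_map.1 hf
    exact Submodule.subset_span ⟨w, rfl⟩
  let S : StarSubalgebra ℝ (A.carrier →ᵇ ℝ) :=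
    { p.toSubalgebra hone hmul with
      star_mem' := fun {f} hf => by
        have : star f = f := by ext x; simp
        rwa [this] }
  refine eq_of_forall_integral_eq (S := S) (fun x y hxy => ?_) fun f hf => ?_
  · by_contra! hcon
    exact hxy (hsep x y fun w => hcon (φ w) (Submodule.subset_span ⟨w, rfl⟩))
  · replace hf : f ∈ Submodule.span ℝ (range φ) := hf
    have hint : ∀ ρ : A.prob.carrier, Integrable G (BorelSp.measureOf ρ) := fun ρ =>
      Integrable.of_bound hG.aestronglyMeasurable C (ae_of_all _ hC)
    induction hf using Submodule.span_induction with
    | mem f hf =>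
      obtain ⟨w, rfl⟩ := hf
      have e : ∀ ρ : A.prob.carrier, ∫ x, φ w x ∂BorelSp.measureOf ρ =
          wordCLM α w (∫ x, G x ∂BorelSp.measureOf ρ) := fun ρ =>
        (wordCLM α w).integral_comp_comm (hint ρ)
      rw [e, e]
      exact congrArg _ hμν
    | zero => simp
    | add f g hf hg ihf ihg =>
      have e : ∀ ρ : A.prob.carrier, ∫ x, (f + g) x ∂BorelSp.measureOf ρ =
          ∫ x, f x ∂BorelSp.measureOf ρ + ∫ x, g x ∂BorelSp.measureOf ρ := fun ρ =>
        integral_add (f.integrable _) (g.integrable _)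
      rw [e, e, ihf, ihg]
    | smul c f hf ihf =>
      have e : ∀ ρ : A.prob.carrier, ∫ x, (c • f) x ∂BorelSp.measureOf ρ =
          c • ∫ x, f x ∂BorelSp.measureOf ρ := fun ρ => integral_smul c _
      rw [e, e, ihf]

theorem continuous_injective_expSig_succ {α : TensorNorms.{u}} {T : ℕ} {F : PathFeature α T}
    (hF : IsCharacteristic F) {A : BorelSp.{u}} [PolishSpace A.carrier] {W : Type u}
    [NormedAddCommGroup W] [NormedSpace ℝ W] {e : A.carrier → W} (he : Continuous e)
    (hinj : Function.Injective e)
    (hb : ∃ C, ∀ x : (A.path T).carrier, ‖F W fun t => e (x t)‖ ≤ C) :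
    (Continuous fun μ : (A.path T).prob.carrier =>
      ∫ x : (A.path T).carrier, F W (fun t => e (x t)) ∂BorelSp.measureOf μ) ∧
    Function.Injective fun μ : (A.path T).prob.carrier =>
      ∫ x : (A.path T).carrier, F W (fun t => e (x t)) ∂BorelSp.measureOf μ := by
  obtain ⟨C, hC⟩ := hb
  have hG : Continuous fun x : (A.path T).carrier => F W fun t => e (x t) :=
    (hF.continuous W).comp (continuous_pi fun t => he.comp (BorelSp.continuous_eval t))
  refine ⟨continuous_integral_of_norm_le hG hC, ?_⟩
  refine injective_integral_of_isGroupLike (A := A.path T) hG hC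
    (fun x => hF.groupLike W _) fun x y h => ?_
  have := hF.separates W _ _ h
  exact funext fun t => hinj (congrFun this t)

/-- The bound `hb` is the only place where robust and classical signatures need different arguments.
It may assume continuity at rank `k`, since for compact state spaces it follows from continuity. -/
theorem continuous_injective_expSig {α : TensorNorms.{u}} {T : ℕ} {F : PathFeature α T}
    (hF : IsCharacteristic F) {U : Type u} [TopologicalSpace U] [MeasurableSpace U] [BorelSpace U]
    [PolishSpace U] {V : Type u} [NormedAddCommGroup V] [NormedSpace ℝ V] {ι : U → V}
    (hι : Continuous ι) (hinj : Function.Injective ι)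
    (hb : ∀ k, Continuous (expSig F ι k) →
      ∃ C, ∀ x : ((probRank T (BorelSp.of U) k).path T).carrier,
        ‖F (TRank α V k).carrier fun t => expSig F ι k (x t)‖ ≤ C) :
    ∀ k, Continuous (expSig F ι k) ∧ Function.Injective (expSig F ι k)
  | 0 => ⟨hι, hinj⟩
  | k + 1 =>
    have ih := continuous_injective_expSig hF hι hinj hb k
    continuous_injective_expSig_succ hF ih.1 ih.2 (hb k ih.1)

/-! ### Comparison of the topologies -/

/-- The map `j` is the inclusion of a compact set of processes or the identity. Only the laws have
to stay in a compact set. -/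
theorem topologies_eq_of_isCompact {T : ℕ} {U : Type u} [TopologicalSpace U] [MeasurableSpace U]
    [BorelSpace U] [PolishSpace U] {r : ℕ} {N : Type*} [NormedAddCommGroup N]
    {Ψ : (probRank T (BorelSp.of U) (r + 1)).carrier → N} (hΨ : Continuous Ψ)
    (hinj : Function.Injective Ψ) {S : Type*} (j : S → AdaptedProcess.{u, w} T U)
    {C : Set (probRank T (BorelSp.of U) (r + 1)).carrier} (hC : IsCompact C)
    (hj : ∀ s, (j s).lawPrediction r ∈ C) :
    (tau T U r).induced j =
        TopologicalSpace.induced (fun s => Ψ ((j s).lawPrediction r)) inferInstance ∧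
      (tau T U r).induced j =
        semimetricTopology
          (fun s s' => ‖Ψ ((j s).lawPrediction r) - Ψ ((j s').lawPrediction r)‖) ∧
      (tau T U r).induced j = (tauHat T U r).induced j := by
  let L : S → (probRank T (BorelSp.of U) (r + 1)).carrier := fun s => (j s).lawPrediction r
  have h1 : (tau T U r).induced j = TopologicalSpace.induced L inferInstance := by
    rw [tau_eq_induced, induced_compose]
    exact induced_comp_eq_of_isCompact (L := L) (continuous_representableIntegrals.{u, w} r)
      (injective_representableIntegrals.{u, w} r) hC hj
  have h2 : TopologicalSpace.induced (fun s => Ψ (L s)) inferInstance =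
      TopologicalSpace.induced L inferInstance :=
    induced_comp_eq_of_isCompact hΨ hinj hC hj
  have h3 : (tauHat T U r).induced j = TopologicalSpace.induced L inferInstance :=
    induced_compose
  refine ⟨h1.trans h2.symm, ?_, h1.trans h3.symm⟩
  exact (h1.trans h2.symm).trans (semimetricTopology_norm_sub fun s => Ψ (L s)).symm

end AdaptedSig

end

/-! ### Proof of the main theorem -/

open AdaptedSig in
theorem theorem4p8 {V : Type u} [NormedAddCommGroup V] [NormedSpace ℝ V] [CompleteSpace V]
    [SecondCountableTopology V] [MeasurableSpace V] [BorelSpace V] (T r : ℕ)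
    (α : TensorNorms.{u}) (Λ : TensorNormalizations α) :
    -- equality of the adapted distributions up to rank `r` is equality of the images under `Φ_r`
    (∀ X Y : AdaptedProcess.{u, w} T V,
      (∀ f ∈ AF T V r, f.expect X = f.expect Y) ↔
        Phi (robustSig α Λ T) (id : V → V) r X = Phi (robustSig α Λ T) (id : V → V) r Y) ∧
    -- on compact sets of processes `Φ_r` induces and `d_r` metrizes `τ_r`
    (∀ 𝒦 : Set (AdaptedProcess.{u, w} T V), @IsCompact _ (tauHat T V r) 𝒦 →
      (tau T V r).induced ((↑) : 𝒦 → AdaptedProcess.{u, w} T V) =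
        TopologicalSpace.induced
          (fun X : 𝒦 => Phi (robustSig α Λ T) (id : V → V) r X.1) inferInstance ∧
      (tau T V r).induced ((↑) : 𝒦 → AdaptedProcess.{u, w} T V) =
        semimetricTopology
          (fun X Y : 𝒦 => sigDist (robustSig α Λ T) (id : V → V) r X.1 Y.1) ∧
      (tau T V r).induced ((↑) : 𝒦 → AdaptedProcess.{u, w} T V) =
        (tauHat T V r).induced ((↑) : 𝒦 → AdaptedProcess.{u, w} T V)) ∧
    -- compact state spaces: no localization, with the robust and with the classical signature
    (∀ K : Set V, IsCompact K →
      ∀ F : PathFeature α T, F = robustSig α Λ T ∨ F = classicalSig α T →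
        (∀ X Y : AdaptedProcess.{u, w} T K,
          (∀ f ∈ AF T K r, f.expect X = f.expect Y) ↔
            Phi F ((↑) : K → V) r X = Phi F ((↑) : K → V) r Y) ∧
        tau.{u, w} T K r =
          TopologicalSpace.induced (fun X => Phi F ((↑) : K → V) r X) inferInstance ∧
        tau.{u, w} T K r =
          semimetricTopology (fun X Y => sigDist F ((↑) : K → V) r X Y) ∧
        tau.{u, w} T K r = tauHat T K r) := by
  have hrob := continuous_injective_expSig (isCharacteristic_robustSig α Λ T)
    (continuous_id (X := V)) Function.injective_id (fun k _ => by
      obtain ⟨C, hC⟩ := (Λ (Aug (TRank α V k).carrier)).bounded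
      exact ⟨C, fun x => hC _ (signature_mem_unital _ _)⟩) (r + 1)
  refine ⟨fun X Y => ?_, fun 𝒦 h𝒦 => ?_, fun K hK F hF => ?_⟩
  · rw [forall_expect_eq_iff]
    exact hrob.2.eq_iff.symm
  -- The map to laws is continuous for `τ̂_r` by definition, so the laws of the processes in `𝒦`
  -- form a compact set.
  · let := tauHat.{u, w} T V r
    have hL : Continuous fun X : AdaptedProcess.{u, w} T V => X.lawPrediction r :=
      continuous_induced_dom
    exact topologies_eq_of_isCompact hrob.1 hrob.2 ((↑) : 𝒦 → AdaptedProcess.{u, w} T V)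
      (h𝒦.image hL) fun X => ⟨X.1, X.2, rfl⟩
  · have hKc : CompactSpace K := isCompact_iff_compactSpace.1 hK
    have hKc' : CompactSpace (BorelSp.of K).carrier := hKc
    have hchar : IsCharacteristic F := by
      rcases hF with rfl | rfl
      · exact isCharacteristic_robustSig α Λ T
      · exact isCharacteristic_classicalSig α T
    -- Path spaces over `Prob_k(K)` are compact, so the continuous feature is bounded whether or not
    -- it is normalized.
    have hexp := continuous_injective_expSig hchar (continuous_subtype_val (p := (· ∈ K)))
      Subtype.val_injective (fun k hk => by
        have := compact_probRank (T := T) (A := BorelSp.of K) k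
        have hc : Continuous fun x : ((probRank T (BorelSp.of K) k).path T).carrier =>
            F (TRank α V k).carrier fun t => expSig F ((↑) : K → V) k (x t) :=
          (hchar.continuous _).comp
            (continuous_pi fun t => hk.comp (BorelSp.continuous_eval t))
        obtain ⟨C, hC⟩ := isCompact_univ.exists_bound_of_continuousOn hc.continuousOn
        exact ⟨C, fun x => hC x (Set.mem_univ x)⟩) (r + 1)
    have := compact_probRank (T := T) (A := BorelSp.of K) (r + 1)
    refine ⟨fun X Y => ?_, ?_⟩
    · rw [forall_expect_eq_iff]
      exact hexp.2.eq_iff.symm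
    · have h := topologies_eq_of_isCompact.{u, w} hexp.1 hexp.2
        (id : AdaptedProcess.{u, w} T K → _) isCompact_univ fun _ => Set.mem_univ _
      simp only [induced_id] at h
      exact h
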